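/- Let $d,n\ge 1$, let $p,q\in[1,\infty]$ with $1/p+1/q=1$, let $r\ge 0$, and let $\ell:\mathbb R\to[0,\infty)$ be convex, decreasing (not necessarily strictly) and $1$-Lipschitz; $\ell'$ denotes its derivative, or any fixed selection of subgradients where $\ell$ is not differentiable. Let $\mathcal D$ be a probability distribution of $(x,y)\in\mathbb R^d\times\{\pm1\}$ with $\|x\|_p\le 1$ almost surely, and let $L_{\mathcal D}^{p,r}(w)=\mathbb E_{(x,y)\sim\mathcal D}\,\sup_{\|x'-x\|_p\le r}\ell(y\langle w,x'\rangle)$ be the population robust loss. Let $S=\{(x_i,y_i)\}_{i=1}^n$ be drawn i.i.d. from $\mathcal D$. Gradient-descent adversarial training on $S$ with step size $\eta$ starts at $w_0=0$ and, for $k=0,1,2,\dots$, chooses perturbations $\delta_i^k\in\arg\max_{\|\delta\|_p\le r}\ell(y_i\langle w_k,x_i+\delta\rangle)$ (ties broken arbitrarily) and sets $$w_{k+1}=w_k-\frac{\eta}{n}\sum_{i=1}^n\ell'\big(y_i\langle w_k,x_i+\delta_i^k\rangle\big)\,y_i\,(x_i+\delta_i^k).$$ Let $w^*\in\mathbb R^d$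 and $\rho>0$ with $\|w^*\|_q\le\rho$. Put $B=\ell(0)+2d^{|1/q-1/2|}(1+r)\rho$, $\bar B=2d^{|1/q-1/2|}B$, and $\mathfrak R_p=\frac1n\mathbb E_\sigma\big\|\sum_{i=1}^n\sigma_i x_i\big\|_p$, where $\sigma_1,\dots,\sigma_n$ are independent uniform random signs (the expectation is over $\sigma$ only). Let $H=4$ if $p\le 2$ and $H=4d$ if $p>2$. Let $\varepsilon>0$, $0<\eta\le\varepsilon H^{-1}/4$, $\delta\in(0,1)$, and $$K=\max\{1,d^{1-2/q}\}\,\eta^{-1}\varepsilon^{-1}\rho^2 .$$ Then, with probability at least $1-\delta$ over $S$, for every such run of the algorithm there is an integer $k^*$ with $0\le k^*\le K$ such that $$L_{\mathcal D}^{p,r}(w_{k^*})\le L_{\mathcal D}^{p,r}(w^*)+\varepsilon+4\bar B\rho\,\mathfrak R_p+4\bar B\,\frac{\rho r}{\sqrt n}+6B\sqrt{\frac{\log(2K/\delta)}{2n}},$$ where the last square root is read as $0$ in case $2K<\delta$. -/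

import Mathlib

open MeasureTheory
open scoped ENNReal

noncomputable section

namespace AdvTraining

/-- The `ℓ_p` norm of a vector of `ℝ^d`, for `p ∈ [1, ∞]`. -/
def vecNorm {d : ℕ} (p : ℝ≥0∞) (x : Fin d → ℝ) : ℝ :=
  ‖(WithLp.toLp p x : PiLp p fun _ : Fin d => ℝ)‖

/-- The closed `ℓ_p` ball of radius `r` centred at `x`. -/
def lpBall {d : ℕ} (p : ℝ≥0∞) (x : Fin d → ℝ) (r : ℝ) : Set (Fin d → ℝ) :=
  {x' | vecNorm p (x - x') ≤ r}

/-- The robust loss of the linear predictor `x ↦ ⟨w, x⟩` at the labelled example `z = (x, y)`: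
the supremum of `ℓ (y ⟨w, x'⟩)` over all `x'` in the `ℓ_p` ball of radius `r` around `x`. -/
def robustLoss {d : ℕ} (ℓ : ℝ → ℝ) (p : ℝ≥0∞) (r : ℝ) (w : Fin d → ℝ)
    (z : (Fin d → ℝ) × ℝ) : ℝ :=
  sSup ((fun x' => ℓ (z.2 * (w ⬝ᵥ x'))) '' lpBall p z.1 r)

/-- The population robust loss `L_D^{p,r}(w)`. -/
def populationRobustLoss {d : ℕ} (ℓ : ℝ → ℝ) (p : ℝ≥0∞) (r : ℝ)
    (D : Measure ((Fin d → ℝ) × ℝ)) (w : Fin d → ℝ) : ℝ :=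
  ∫ z, robustLoss ℓ p r w z ∂D

/-- `g` selects a subgradient of `ℓ` at every point; where the convex function `ℓ` is
differentiable this forces `g z` to be the derivative of `ℓ` at `z`. -/
def IsSubgradientSelection (ℓ g : ℝ → ℝ) : Prop :=
  ∀ z u : ℝ, ℓ z + g z * (u - z) ≤ ℓ u

/-- `δ` is a worst-case perturbation, of `ℓ_p` norm at most `r`, of the example `z = (x, y)`
for the weight vector `w`. -/
def IsWorstPerturbation {d : ℕ} (ℓ : ℝ → ℝ) (p : ℝ≥0∞) (r : ℝ) (w : Fin d → ℝ)
    (z : (Fin d → ℝ) × ℝ) (δ : Fin d → ℝ) : Prop :=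
  vecNorm p δ ≤ r ∧
    ∀ δ' : Fin d → ℝ, vecNorm p δ' ≤ r →
      ℓ (z.2 * (w ⬝ᵥ (z.1 + δ'))) ≤ ℓ (z.2 * (w ⬝ᵥ (z.1 + δ)))

/-- `w 0, w 1, …` are the iterates of a run of gradient-descent adversarial training on the
sample `S`, with step size `η` and derivative (subgradient) `g` of the loss: in every round each
example is perturbed by a worst-case perturbation (ties in the argmax are broken arbitrarily),
and then one gradient step is made in which the perturbed examples are treated as constants. -/
def IsAdversarialTrainingRun {d n : ℕ} (ℓ g : ℝ → ℝ) (p : ℝ≥0∞) (r η : ℝ)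
    (S : Fin n → (Fin d → ℝ) × ℝ) (w : ℕ → Fin d → ℝ) : Prop :=
  ∀ k : ℕ, ∃ δ : Fin n → Fin d → ℝ,
    (∀ i, IsWorstPerturbation ℓ p r (w k) (S i) (δ i)) ∧
    w (k + 1) = w k - (η / n) • ∑ i,
      (g ((S i).2 * (w k ⬝ᵥ ((S i).1 + δ i))) * (S i).2) • ((S i).1 + δ i)

/-- `n⁻¹ E_σ ‖∑ i, σ_i x_i‖_p`, the expectation being over independent uniform random signs
`σ_1, …, σ_n`, i.e. the average over all `2 ^ n` sign vectors. -/
def rademacherNorm {d n : ℕ} (p : ℝ≥0∞) (x : Fin n → Fin d → ℝ) : ℝ :=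
  (n : ℝ)⁻¹ * ((∑ σ : Fin n → ℤˣ, vecNorm p (∑ i, ((σ i : ℤ) : ℝ) • x i)) / 2 ^ n)

/-- The constant `H` of the step size condition: `4` if `p ≤ 2` and `4 d` if `p > 2`. -/
def stepConst (d : ℕ) (p : ℝ≥0∞) : ℝ :=
  if p ≤ 2 then 4 else 4 * d

/-- `d ^ |1/q - 1/2|`, with `1/∞ = 0`. -/
def dimFactor (d : ℕ) (q : ℝ≥0∞) : ℝ :=
  (d : ℝ) ^ |(q⁻¹).toReal - 1 / 2|

/-- `B = ℓ(0) + 2 d ^ |1/q - 1/2| (1 + r) ρ`. -/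
def lossBound (d : ℕ) (ℓ : ℝ → ℝ) (q : ℝ≥0∞) (r ρ : ℝ) : ℝ :=
  ℓ 0 + 2 * dimFactor d q * (1 + r) * ρ

/-- `B̄ = 2 d ^ |1/q - 1/2| B`. -/
def lossBoundBar (d : ℕ) (ℓ : ℝ → ℝ) (q : ℝ≥0∞) (r ρ : ℝ) : ℝ :=
  2 * dimFactor d q * lossBound d ℓ q r ρ

/-- The number of iterations `K = max {1, d ^ (1 - 2/q)} η⁻¹ ε⁻¹ ρ²`, with `1/∞ = 0`. -/
def iterationBound (d : ℕ) (q : ℝ≥0∞) (η ε ρ : ℝ) : ℝ :=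
  max 1 ((d : ℝ) ^ (1 - 2 * (q⁻¹).toReal)) * η⁻¹ * ε⁻¹ * ρ ^ 2

end AdvTraining

end

open AdvTraining

/-
By duality the worst-case perturbation of `(x, y)` lowers the margin of `w` by `r ‖w‖_q`, so the
robust loss is `ℓ` evaluated at the robust margin `y ⟨w, x⟩ - r ‖w‖_q`, and training takes
subgradient steps for the convex empirical robust loss. The standard potential argument shows that
within `K` steps an iterate has empirical loss at most that of `w*` plus `ε`, and that this iterate
is no farther from `w*` than the starting point `0`. It therefore suffices to control the deviation
between population and empirical excess loss over the Euclidean ball around `w*` of radius `‖w*‖₂`.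

On that ball the robust margin relative to `w*` is an inner product in a Euclidean space with one
extra coordinate for `‖w‖_q - ‖w*‖_q`. Symmetrization and contraction by the `1`-Lipschitz `ℓ` bound
the exponential moment of the supremum by the expectation of `2 cosh ‖∑ σᵢ xᵢ‖` up to scaling, and
`cosh ‖v + x‖ + cosh ‖v - x‖ ≤ 2 cosh ‖v‖ cosh ‖x‖` bounds that by `2 cosh(c)ⁿ`. This sub-Gaussian
tail is free of the dimension and of any separate complexity term. If `0` already competes with
`w*` up to `ε`, which happens whenever `r ≥ 1`, there is nothing to prove.
-/

namespace AdvTraining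

section Exponential

variable {ι : Type*}

theorem exp_add_add_exp_sub_le_of_nonneg {a b s t x y U V : ℝ} (hy : |y| ≤ |t|)
    (hxy : |x - y| ≤ |s - t|) (ht : 0 ≤ t) (hts : t ≤ s) (has : Real.exp (a + s) ≤ U)
    (hbt : Real.exp (b + t) ≤ U) (hbt' : Real.exp (b - t) ≤ V) :
    Real.exp (a + x) + Real.exp (b - y) ≤ U + V := by
  rw [abs_of_nonneg ht] at hy
  rw [abs_of_nonneg (sub_nonneg.2 hts)] at hxy
  obtain ⟨hy₁, hy₂⟩ := abs_le.1 hy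
  have hxy₂ := (abs_le.1 hxy).2
  rcases le_total (b - t) (a + x) with h | h
  · have hby : Real.exp (b - y) = Real.exp (b - t) * Real.exp (t - y) := by
      rw [← Real.exp_add]; ring_nf
    have has' : Real.exp (a + s) = Real.exp (a + x) * Real.exp (s - x) := by
      rw [← Real.exp_add]; ring_nf
    have hgap : Real.exp (b - t) * (Real.exp (t - y) - 1)
        ≤ Real.exp (a + x) * (Real.exp (s - x) - 1) := by
      have hmono : Real.exp (t - y) ≤ Real.exp (s - x) := Real.exp_le_exp.2 (by linarith)
      have hone : 1 ≤ Real.exp (t - y) := Real.one_le_exp (by linarith)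
      exact mul_le_mul (Real.exp_le_exp.2 h) (by linarith) (by linarith) (Real.exp_pos _).le
    linarith
  · have hby : Real.exp (b - y) ≤ Real.exp (b + t) := Real.exp_le_exp.2 (by linarith)
    linarith [Real.exp_le_exp.2 h]

theorem exp_add_add_exp_sub_le_of_le {a b s t x y U V : ℝ} (hx : |x| ≤ |s|) (hy : |y| ≤ |t|)
    (hxy : |x - y| ≤ |s - t|) (hts : t ≤ s) (has : Real.exp (a + s) ≤ U)
    (hbt : Real.exp (b + t) ≤ U) (has' : Real.exp (a - s) ≤ V) (hbt' : Real.exp (b - t) ≤ V) :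
    Real.exp (a + x) + Real.exp (b - y) ≤ U + V := by
  rcases le_total 0 t with ht | ht
  · exact exp_add_add_exp_sub_le_of_nonneg hy hxy ht hts has hbt hbt'
  rcases le_total 0 s with hs | hs
  · rw [abs_of_nonneg hs] at hx
    rw [abs_of_nonpos ht] at hy
    have hax : Real.exp (a + x) ≤ Real.exp (a + s) :=
      Real.exp_le_exp.2 (by linarith [(abs_le.1 hx).2])
    have hby : Real.exp (b - y) ≤ Real.exp (b - t) :=
      Real.exp_le_exp.2 (by linarith [(abs_le.1 hy).1])
    linarith
  · have hswap := exp_add_add_exp_sub_le_of_nonneg (a := b) (b := a) (s := -t) (t := -s)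
      (x := -y) (y := -x) (U := V) (V := U) (by simpa using hx)
      (by rwa [neg_sub_neg, neg_sub_neg]) (by linarith) (by linarith)
      (by rwa [← sub_eq_add_neg]) (by rwa [← sub_eq_add_neg]) (by rwa [sub_neg_eq_add])
    rw [sub_neg_eq_add, ← sub_eq_add_neg] at hswap
    linarith

theorem exp_add_add_exp_sub_le {a b s t x y U V : ℝ} (hx : |x| ≤ |s|) (hy : |y| ≤ |t|)
    (hxy : |x - y| ≤ |s - t|) (has : Real.exp (a + s) ≤ U) (hbt : Real.exp (b + t) ≤ U)
    (has' : Real.exp (a - s) ≤ V) (hbt' : Real.exp (b - t) ≤ V) :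
    Real.exp (a + x) + Real.exp (b - y) ≤ U + V := by
  rcases le_total t s with hts | hst
  · exact exp_add_add_exp_sub_le_of_le hx hy hxy hts has hbt has' hbt'
  · have hswap := exp_add_add_exp_sub_le_of_le (a := b) (b := a) (s := t) (t := s) (x := -y)
      (y := -x) (by simpa using hy) (by simpa using hx)
      (by rwa [neg_sub_neg, abs_sub_comm t s]) hst hbt has hbt' has'
    rw [sub_neg_eq_add, ← sub_eq_add_neg] at hswap
    linarith

/-- The family `φ` is obtained from the family `u` by some `1`-Lipschitz function vanishing at `0`;
stated on the values, so that this function need not be named. -/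
def IsContraction (φ u : ι → ℝ) : Prop :=
  (∀ i, |φ i| ≤ |u i|) ∧ ∀ i j, |φ i - φ j| ≤ |u i - u j|

theorem IsContraction.const_mul {φ u : ι → ℝ} (h : IsContraction φ u) (c : ℝ) :
    IsContraction (fun i => c * φ i) fun i => c * u i := by
  refine ⟨fun i => ?_, fun i j => ?_⟩
  · rw [abs_mul, abs_mul]
    exact mul_le_mul_of_nonneg_left (h.1 i) (abs_nonneg c)
  · rw [← mul_sub, ← mul_sub, abs_mul, abs_mul]
    exact mul_le_mul_of_nonneg_left (h.2 i j) (abs_nonneg c)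

/-- The exponential `exp (sup_i f i)` inside the moments of a supremum; it takes values in `ℝ≥0∞` so
that these moments are Lebesgue integrals, free of integrability conditions. -/
noncomputable def expSup (f : ι → ℝ) : ℝ≥0∞ :=
  ENNReal.ofReal (Real.exp (⨆ i, f i))

theorem expSup_le [Nonempty ι] {f : ι → ℝ} {c : ℝ} (h : ∀ i, f i ≤ c) :
    expSup f ≤ ENNReal.ofReal (Real.exp c) :=
  ENNReal.ofReal_le_ofReal (Real.exp_le_exp.2 (ciSup_le h))

theorem measurable_expSup [Countable ι] {Z : Type*} [MeasurableSpace Z] {f : ι → Z → ℝ}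
    (hf : ∀ i, Measurable (f i)) : Measurable fun z => expSup fun i => f i z :=
  (Real.measurable_exp.comp (Measurable.iSup hf)).ennreal_ofReal

variable [Finite ι]

theorem exp_le_exp_iSup (f : ι → ℝ) (i : ι) : Real.exp (f i) ≤ Real.exp (⨆ j, f j) :=
  Real.exp_le_exp.2 (le_ciSup (Finite.bddAbove_range f) i)

theorem ofReal_exp_le_expSup (f : ι → ℝ) (i : ι) : ENNReal.ofReal (Real.exp (f i)) ≤ expSup f :=
  ENNReal.ofReal_le_ofReal (exp_le_exp_iSup f i)

variable [Nonempty ι]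

theorem exists_expSup_eq (f : ι → ℝ) : ∃ i, expSup f = ENNReal.ofReal (Real.exp (f i)) := by
  obtain ⟨i, hi⟩ := exists_eq_ciSup_of_finite (f := f)
  exact ⟨i, by rw [expSup, hi]⟩

theorem expSup_half_add_le (f g : ι → ℝ) :
    (expSup fun i => (f i + g i) / 2) ≤ 2⁻¹ * (expSup f + expSup g) := by
  obtain ⟨i, hi⟩ := exists_expSup_eq fun i => (f i + g i) / 2
  have hconv : Real.exp ((f i + g i) / 2) ≤ 2⁻¹ * (Real.exp (f i) + Real.exp (g i)) := by
    have h := convexOn_exp.2 (Set.mem_univ (f i)) (Set.mem_univ (g i))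
      (by norm_num : (0 : ℝ) ≤ 2⁻¹) (by norm_num : (0 : ℝ) ≤ 2⁻¹) (by norm_num)
    rwa [← smul_add, ← smul_add, smul_eq_mul, smul_eq_mul, inv_mul_eq_div 2 (f i + g i)] at h
  calc (expSup fun i => (f i + g i) / 2)
      ≤ ENNReal.ofReal (2⁻¹ * (Real.exp (f i) + Real.exp (g i))) :=
        hi.trans_le (ENNReal.ofReal_le_ofReal hconv)
    _ = 2⁻¹ * (ENNReal.ofReal (Real.exp (f i)) + ENNReal.ofReal (Real.exp (g i))) := by
        rw [ENNReal.ofReal_mul (by norm_num), ENNReal.ofReal_inv_of_pos two_pos,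
          ENNReal.ofReal_ofNat, ENNReal.ofReal_add (Real.exp_pos _).le (Real.exp_pos _).le]
    _ ≤ 2⁻¹ * (expSup f + expSup g) := by
        gcongr
        exacts [ofReal_exp_le_expSup f i, ofReal_exp_le_expSup g i]

theorem IsContraction.expSup_add_expSup_le {φ u : ι → ℝ} (h : IsContraction φ u) (a : ι → ℝ) :
    (expSup fun i => a i + φ i) + (expSup fun i => a i - φ i) ≤
      (expSup fun i => a i + u i) + expSup fun i => a i - u i := by
  obtain ⟨i, hi⟩ := exists_expSup_eq fun i => a i + φ i
  obtain ⟨j, hj⟩ := exists_expSup_eq fun i => a i - φ i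
  rw [hi, hj, expSup, expSup, ← ENNReal.ofReal_add (Real.exp_pos _).le (Real.exp_pos _).le,
    ← ENNReal.ofReal_add (Real.exp_pos _).le (Real.exp_pos _).le]
  exact ENNReal.ofReal_le_ofReal (exp_add_add_exp_sub_le (h.1 i) (h.1 j) (h.2 i j)
    (exp_le_exp_iSup (fun i => a i + u i) i) (exp_le_exp_iSup (fun i => a i + u i) j)
    (exp_le_exp_iSup (fun i => a i - u i) i) (exp_le_exp_iSup (fun i => a i - u i) j))

end Exponential

section CoshNorm

theorem convexOn_map_add_add_map_sub_le {s : Set ℝ} {f : ℝ → ℝ} (hf : ConvexOn ℝ s f) {a b c : ℝ}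
    (hbc : |b| ≤ c) (hadd : a + c ∈ s) (hsub : a - c ∈ s) :
    f (a + b) + f (a - b) ≤ f (a + c) + f (a - c) := by
  rcases ((abs_nonneg b).trans hbc).eq_or_lt with rfl | hc
  · rw [abs_nonpos_iff.1 hbc]
  obtain ⟨hb₁, hb₂⟩ := abs_le.1 hbc
  have hp : 0 ≤ (c + b) / (2 * c) := div_nonneg (by linarith) (by linarith)
  have hm : 0 ≤ (c - b) / (2 * c) := div_nonneg (by linarith) (by linarith)
  have hpm : (c + b) / (2 * c) + (c - b) / (2 * c) = 1 := by field_simp; ring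
  have h₁ := hf.2 hadd hsub hp hm hpm
  have h₂ := hf.2 hsub hadd hp hm hpm
  simp only [smul_eq_mul] at h₁ h₂
  rw [show (c + b) / (2 * c) * (a + c) + (c - b) / (2 * c) * (a - c) = a + b by field_simp; ring]
    at h₁
  rw [show (c + b) / (2 * c) * (a - c) + (c - b) / (2 * c) * (a + c) = a - b by field_simp; ring]
    at h₂
  linear_combination h₁ + h₂ + (f (a + c) + f (a - c)) * hpm

variable {E : Type*} [NormedAddCommGroup E] [InnerProductSpace ℝ E]

theorem cosh_norm_add_add_cosh_norm_sub_le (v x : E) :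
    Real.cosh ‖v + x‖ + Real.cosh ‖v - x‖ ≤ 2 * Real.cosh ‖v‖ * Real.cosh ‖x‖ := by
  have hprod : 2 * Real.cosh ‖v‖ * Real.cosh ‖x‖
      = Real.cosh (‖v‖ + ‖x‖) + Real.cosh (‖v‖ - ‖x‖) := by
    rw [Real.cosh_add, Real.cosh_sub]; ring
  rw [hprod]
  -- Compare the power series in the squared norms, which all have the form `‖v‖² + ‖x‖² ± 2c`.
  refine hasSum_le (fun k => ?_)
    ((Real.hasSum_cosh ‖v + x‖).add (Real.hasSum_cosh ‖v - x‖))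
    ((Real.hasSum_cosh (‖v‖ + ‖x‖)).add (Real.hasSum_cosh (‖v‖ - ‖x‖)))
  rw [← add_div, ← add_div]
  simp only [pow_mul]
  rw [norm_add_sq_real, norm_sub_sq_real, add_sq, sub_sq, add_right_comm, sub_add_eq_add_sub,
    add_right_comm (‖v‖ ^ 2) (2 * ‖v‖ * ‖x‖), sub_add_eq_add_sub]
  gcongr ?_ / _
  refine convexOn_map_add_add_map_sub_le (convexOn_pow k) ?_ ?_ ?_
  · rw [abs_mul, abs_two, mul_assoc]
    exact mul_le_mul_of_nonneg_left (abs_real_inner_le_norm v x) two_pos.le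
  · rw [Set.mem_Ici]; positivity
  · rw [Set.mem_Ici]; nlinarith [sq_nonneg (‖v‖ - ‖x‖)]

theorem cosh_mul_norm_add_add_cosh_mul_norm_sub_le {R : ℝ} (hR : 0 ≤ R) (v x : E) :
    Real.cosh (R * ‖v + x‖) + Real.cosh (R * ‖v - x‖) ≤
      2 * Real.cosh (R * ‖v‖) * Real.cosh (R * ‖x‖) := by
  have h := cosh_norm_add_add_cosh_norm_sub_le (R • v) (R • x)
  rw [← smul_add, ← smul_sub] at h
  simpa only [norm_smul, Real.norm_of_nonneg hR] using h

end CoshNorm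

section SubGaussian

variable {Z : Type*} [MeasurableSpace Z] {D : Measure Z}
  {E : Type*} [NormedAddCommGroup E] [InnerProductSpace ℝ E] {ι : Type*}

theorem lintegral_pi_fin_succ [SigmaFinite D] {n : ℕ} {f : (Fin (n + 1) → Z) → ℝ≥0∞}
    (hf : Measurable f) :
    ∫⁻ S, f S ∂(Measure.pi fun _ => D) =
      ∫⁻ S, ∫⁻ z, f (Fin.cons z S) ∂D ∂(Measure.pi fun _ : Fin n => D) := by
  rw [(measurePreserving_piFinSuccAbove (fun _ : Fin (n + 1) => D) 0).symm.lintegral_map_equiv,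
    lintegral_prod_symm']
  · simp only [MeasurableEquiv.piFinSuccAbove_symm_apply, Fin.insertNthEquiv_zero]
    rfl
  · exact hf.comp (MeasurableEquiv.measurable _)

theorem ofReal_exp_integral_le_lintegral [IsProbabilityMeasure D] {f : Z → ℝ}
    (hf : Integrable f D) :
    ENNReal.ofReal (Real.exp (∫ z, f z ∂D)) ≤ ∫⁻ z, ENNReal.ofReal (Real.exp (f z)) ∂D := by
  by_cases hexp : Integrable (fun z => Real.exp (f z)) D
  · rw [← ofReal_integral_eq_lintegral_ofReal hexp (ae_of_all _ fun z => (Real.exp_pos _).le)]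
    exact ENNReal.ofReal_le_ofReal (convexOn_exp.map_integral_le Real.continuous_exp.continuousOn
      isClosed_univ (ae_of_all _ fun z => Set.mem_univ (f z)) hf hexp)
  · have htop : ∫⁻ z, ENNReal.ofReal (Real.exp (f z)) ∂D = ∞ := by
      by_contra hfin
      exact hexp ((lintegral_ofReal_ne_top_iff_integrable
        (Real.continuous_exp.comp_aestronglyMeasurable hf.aestronglyMeasurable)
        (ae_of_all _ fun z => (Real.exp_pos _).le)).1 hfin)
    exact htop ▸ le_top

variable [Finite ι] [Nonempty ι] [IsProbabilityMeasure D]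

theorem expSup_add_integral_le_lintegral (a : ι → ℝ) {f : ι → Z → ℝ}
    (hf : ∀ i, Integrable (f i) D) :
    (expSup fun i => a i + ∫ z, f i z ∂D) ≤ ∫⁻ z, (expSup fun i => a i + f i z) ∂D := by
  obtain ⟨i, hi⟩ := exists_expSup_eq fun i => a i + ∫ z, f i z ∂D
  have hmean : a i + ∫ z, f i z ∂D = ∫ z, (a i + f i z) ∂D := by
    rw [integral_add (integrable_const _) (hf i), integral_const, probReal_univ, one_smul]
  rw [hi, hmean]
  exact (ofReal_exp_integral_le_lintegral ((integrable_const _).add (hf i))).trans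
    (lintegral_mono fun z => ofReal_exp_le_expSup (fun i => a i + f i z) i)

-- No independent copy of the sample is needed: convexity separates the mean from `-h z`, doubling
-- both, and Jensen's inequality replaces the doubled mean by `2 * h z`.
theorem lintegral_expSup_symmetrization_le (a : ι → ℝ) {h u : ι → Z → ℝ}
    (hh : ∀ i, Integrable (h i) D) (hcontr : ∀ z, IsContraction (h · z) (u · z)) :
    ∫⁻ z, (expSup fun i => a i + (∫ z', h i z' ∂D - h i z)) ∂D ≤
      ∫⁻ z, 2⁻¹ * ((expSup fun i => a i + 2 * u i z) + expSup fun i => a i - 2 * u i z) ∂D := by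
  have hsplit : ∀ z, (expSup fun i => a i + (∫ z', h i z' ∂D - h i z)) ≤
      2⁻¹ * ((expSup fun i => a i + ∫ z', 2 * h i z' ∂D) + expSup fun i => a i - 2 * h i z) := by
    intro z
    refine (congrArg expSup (funext fun i => ?_)).trans_le (expSup_half_add_le _ _)
    rw [integral_const_mul]
    ring
  have htwo : (2⁻¹ : ℝ≥0∞) ≠ ∞ := by norm_num
  calc ∫⁻ z, (expSup fun i => a i + (∫ z', h i z' ∂D - h i z)) ∂D
      ≤ ∫⁻ z, 2⁻¹ * ((expSup fun i => a i + ∫ z', 2 * h i z' ∂D)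
          + expSup fun i => a i - 2 * h i z) ∂D := lintegral_mono hsplit
    _ = 2⁻¹ * ((expSup fun i => a i + ∫ z', 2 * h i z' ∂D)
          + ∫⁻ z, (expSup fun i => a i - 2 * h i z) ∂D) := by
        rw [lintegral_const_mul' _ _ htwo, lintegral_add_left measurable_const, lintegral_const,
          measure_univ, mul_one]
    _ ≤ 2⁻¹ * (∫⁻ z, (expSup fun i => a i + 2 * h i z) ∂D
          + ∫⁻ z, (expSup fun i => a i - 2 * h i z) ∂D) := by
        gcongr
        exact expSup_add_integral_le_lintegral a fun i => (hh i).const_mul 2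
    _ ≤ 2⁻¹ * ∫⁻ z, ((expSup fun i => a i + 2 * h i z) + expSup fun i => a i - 2 * h i z) ∂D := by
        gcongr
        exact le_lintegral_add _ _
    _ ≤ 2⁻¹ * ∫⁻ z, ((expSup fun i => a i + 2 * u i z) + expSup fun i => a i - 2 * u i z) ∂D := by
        gcongr 2⁻¹ * ?_
        exact lintegral_mono fun z => ((hcontr z).const_mul 2).expSup_add_expSup_le a
    _ = _ := (lintegral_const_mul' _ _ htwo).symm

theorem lintegral_pi_expSup_succ_le (a : ι → ℝ) {h u : ι → Z → ℝ} (hhm : ∀ i, Measurable (h i))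
    (hh : ∀ i, Integrable (h i) D) (hu : ∀ i, Measurable (u i))
    (hcontr : ∀ z, IsContraction (h · z) (u · z)) (n : ℕ) :
    ∫⁻ S, (expSup fun i => a i + ∑ k, (∫ z', h i z' ∂D - h i (S k)))
        ∂(Measure.pi fun _ : Fin (n + 1) => D) ≤
      ∫⁻ z, 2⁻¹ *
        (∫⁻ S, (expSup fun i => a i + 2 * u i z + ∑ k, (∫ z', h i z' ∂D - h i (S k)))
            ∂(Measure.pi fun _ : Fin n => D)
          + ∫⁻ S, (expSup fun i => a i - 2 * u i z + ∑ k, (∫ z', h i z' ∂D - h i (S k)))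
            ∂(Measure.pi fun _ : Fin n => D)) ∂D := by
  have hsum : ∀ (m : ℕ) i, Measurable fun S : Fin m → Z => ∑ k, (∫ z', h i z' ∂D - h i (S k)) :=
    fun m i => Finset.measurable_fun_sum _ fun k _ =>
      ((hhm i).comp (measurable_pi_apply k)).const_sub _
  have hplus : Measurable fun y : (Fin n → Z) × Z =>
      expSup fun i => a i + 2 * u i y.2 + ∑ k, (∫ z', h i z' ∂D - h i (y.1 k)) :=
    measurable_expSup fun i => ((((hu i).comp measurable_snd).const_mul 2).const_add _).add
      ((hsum n i).comp measurable_fst)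
  have hminus : Measurable fun y : (Fin n → Z) × Z =>
      expSup fun i => a i - 2 * u i y.2 + ∑ k, (∫ z', h i z' ∂D - h i (y.1 k)) :=
    measurable_expSup fun i => ((((hu i).comp measurable_snd).const_mul 2).const_sub _).add
      ((hsum n i).comp measurable_fst)
  rw [lintegral_pi_fin_succ (measurable_expSup fun i => (hsum (n + 1) i).const_add _)]
  refine (lintegral_mono (g := fun S : Fin n → Z => ∫⁻ z, 2⁻¹ *
    ((expSup fun i => a i + 2 * u i z + ∑ k, (∫ z', h i z' ∂D - h i (S k)))
      + expSup fun i => a i - 2 * u i z + ∑ k, (∫ z', h i z' ∂D - h i (S k))) ∂D)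
    fun S => ?_).trans ?_
  · have hsym := lintegral_expSup_symmetrization_le
      (fun i => a i + ∑ k, (∫ z', h i z' ∂D - h i (S k))) hh hcontr
    simp only [add_right_comm, add_sub_right_comm] at hsym
    simpa only [Fin.sum_univ_succ, Fin.cons_zero, Fin.cons_succ, add_assoc, add_left_comm,
      add_comm] using hsym
  · rw [lintegral_lintegral_swap ((hplus.add hminus).const_mul 2⁻¹).aemeasurable]
    refine lintegral_mono fun z => ?_
    rw [lintegral_const_mul' _ _ (by norm_num), lintegral_add_left]
    exact measurable_expSup fun i => (hsum n i).const_add _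

theorem lintegral_expSup_inner_add_sum_le (e : ι → E) {R : ℝ} (he : ∀ i, ‖e i‖ ≤ R) (x : Z → E)
    {c : ℝ} (hx : ∀ᵐ z ∂D, ‖x z‖ ≤ c) (hxm : ∀ i, Measurable fun z => inner ℝ (e i) (x z))
    {h : ι → Z → ℝ} (hh : ∀ i, Measurable (h i))
    (hcontr : ∀ z, IsContraction (h · z) fun i => inner ℝ (e i) (x z)) (n : ℕ) (v : E) :
    ∫⁻ S, (expSup fun i => inner ℝ (e i) v + ∑ k, (∫ z', h i z' ∂D - h i (S k)))
        ∂(Measure.pi fun _ : Fin n => D) ≤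
      ENNReal.ofReal (2 * Real.cosh (R * ‖v‖) * Real.cosh (2 * (R * c)) ^ n) := by
  have hR : 0 ≤ R := (norm_nonneg _).trans (he (Classical.arbitrary ι))
  have hinner : ∀ i y, |inner ℝ (e i) y| ≤ R * ‖y‖ := fun i y =>
    (abs_real_inner_le_norm _ _).trans (mul_le_mul_of_nonneg_right (he i) (norm_nonneg y))
  have hint : ∀ i, Integrable (h i) D := fun i =>
    Integrable.of_bound (hh i).aestronglyMeasurable (R * c) (by
      filter_upwards [hx] with z hz
      exact ((hcontr z).1 i).trans
        ((hinner i _).trans (mul_le_mul_of_nonneg_left hz hR)))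
  induction n generalizing v with
  | zero =>
    simp only [Finset.univ_eq_empty, Finset.sum_empty, add_zero, pow_zero, mul_one,
      lintegral_const, measure_univ]
    refine (expSup_le fun i => (le_abs_self _).trans (hinner i v)).trans
      (ENNReal.ofReal_le_ofReal ?_)
    linarith [Real.cosh_eq (R * ‖v‖), Real.exp_pos (-(R * ‖v‖))]
  | succ n ih =>
    refine (lintegral_pi_expSup_succ_le (fun i => inner ℝ (e i) v) hh hint hxm hcontr n).trans ?_
    refine (lintegral_mono_ae (g := fun _ => ENNReal.ofReal
      (2 * Real.cosh (R * ‖v‖) * Real.cosh (2 * (R * c)) ^ (n + 1))) ?_).trans (by simp)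
    filter_upwards [hx] with z hz
    simp only [← real_inner_smul_right, ← inner_add_right, ← inner_sub_right]
    have hpow : 0 < Real.cosh (2 * (R * c)) ^ n := pow_pos (Real.cosh_pos _) n
    have hcosh : Real.cosh (R * ‖v + (2 : ℝ) • x z‖) + Real.cosh (R * ‖v - (2 : ℝ) • x z‖) ≤
        2 * Real.cosh (R * ‖v‖) * Real.cosh (2 * (R * c)) := by
      refine (cosh_mul_norm_add_add_cosh_mul_norm_sub_le hR v _).trans ?_
      gcongr
      rw [norm_smul, Real.norm_two, mul_left_comm, Real.cosh_le_cosh]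
      exact abs_le_abs_of_nonneg (by positivity) (by gcongr)
    refine (mul_le_mul_right (add_le_add (ih _) (ih _)) _).trans ?_
    rw [← ENNReal.ofReal_add (by positivity) (by positivity), ← ENNReal.ofReal_ofNat 2,
      ← ENNReal.ofReal_inv_of_pos two_pos, ← ENNReal.ofReal_mul (by norm_num)]
    refine ENNReal.ofReal_le_ofReal ?_
    rw [pow_succ']
    linear_combination mul_le_mul_of_nonneg_right hcosh hpow.le

theorem measure_pi_exists_le_sum_le (e : ι → E) {R : ℝ} (he : ∀ i, ‖e i‖ ≤ R) (x : Z → E) {c : ℝ}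
    (hx : ∀ᵐ z ∂D, ‖x z‖ ≤ c) (hxm : ∀ i, Measurable fun z => inner ℝ (e i) (x z))
    {h : ι → Z → ℝ} (hh : ∀ i, Measurable (h i))
    (hcontr : ∀ z, IsContraction (h · z) fun i => inner ℝ (e i) (x z)) (hRc : R * c ≠ 0) (n : ℕ)
    {t : ℝ} (ht : 0 ≤ t) :
    (Measure.pi fun _ : Fin n => D) {S | ∃ i, n * t ≤ ∑ k, (∫ z', h i z' ∂D - h i (S k))} ≤
      ENNReal.ofReal (2 * Real.exp (-(n * t ^ 2 / (8 * (R * c) ^ 2)))) := by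
  -- The minimizer of the Chernoff exponent `2 (s R c)² - s t`.
  set s : ℝ := t / (4 * (R * c) ^ 2) with hs
  have hs0 : 0 ≤ s := by positivity
  have hmoment := lintegral_expSup_inner_add_sum_le (D := D) (fun i => s • e i) (R := s * R)
    (fun i => by rw [norm_smul, Real.norm_of_nonneg hs0]; gcongr; exact he i) x hx
    (fun i => by simp only [real_inner_smul_left]; exact (hxm i).const_mul s)
    (fun i => (hh i).const_mul s)
    (fun z => by simp only [real_inner_smul_left]; exact (hcontr z).const_mul s) n 0
  simp only [inner_zero_right, zero_add, norm_zero, mul_zero, Real.cosh_zero, mul_one,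
    integral_const_mul, ← mul_sub, ← Finset.mul_sum, mul_assoc s R c] at hmoment
  have hmeas : Measurable fun S : Fin n → Z =>
      expSup fun i => s * ∑ k, (∫ z', h i z' ∂D - h i (S k)) :=
    measurable_expSup fun i => (Finset.measurable_fun_sum _ fun k _ =>
      ((hh i).comp (measurable_pi_apply k)).const_sub _).const_mul s
  calc (Measure.pi fun _ : Fin n => D) {S | ∃ i, n * t ≤ ∑ k, (∫ z', h i z' ∂D - h i (S k))}
      ≤ (Measure.pi fun _ : Fin n => D) {S | ENNReal.ofReal (Real.exp (s * (n * t))) ≤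
          expSup fun i => s * ∑ k, (∫ z', h i z' ∂D - h i (S k))} :=
        measure_mono fun S ⟨i, hi⟩ => (ENNReal.ofReal_le_ofReal (Real.exp_le_exp.2
          (mul_le_mul_of_nonneg_left hi hs0))).trans (ofReal_exp_le_expSup _ i)
    _ ≤ ENNReal.ofReal (2 * Real.cosh (2 * (s * (R * c))) ^ n) /
          ENNReal.ofReal (Real.exp (s * (n * t))) :=
        (meas_ge_le_lintegral_div hmeas.aemeasurable (by simp [Real.exp_pos])
          ENNReal.ofReal_ne_top).trans (ENNReal.div_le_div_right hmoment _)
    _ = ENNReal.ofReal (2 * Real.cosh (2 * (s * (R * c))) ^ n / Real.exp (s * (n * t))) :=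
        (ENNReal.ofReal_div_of_pos (Real.exp_pos _)).symm
    _ ≤ ENNReal.ofReal
          (2 * Real.exp ((2 * (s * (R * c))) ^ 2 / 2) ^ n / Real.exp (s * (n * t))) := by
        gcongr
        exact Real.cosh_le_exp_half_sq _
    _ = ENNReal.ofReal (2 * Real.exp (-(n * t ^ 2 / (8 * (R * c) ^ 2)))) := by
        rw [← Real.exp_nat_mul, mul_div_assoc, ← Real.exp_sub]
        congr 3
        rw [hs]
        field_simp
        ring

theorem measure_exists_lt_le_of_forall_fin {Ω X : Type*} [MeasurableSpace Ω] {μ : Measure Ω}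
    [TopologicalSpace X] [TopologicalSpace.SeparableSpace X] [Nonempty X] {F : Ω → X → ℝ}
    (hF : ∀ᵐ ω ∂μ, LowerSemicontinuous (F ω)) {t : ℝ} {b : ℝ≥0∞}
    (h : ∀ (k : ℕ) (u : Fin (k + 1) → X), μ {ω | ∃ i, t < F ω (u i)} ≤ b) :
    μ {ω | ∃ x, t < F ω x} ≤ b := by
  have hdense : {ω | ∃ x, t < F ω x} ≤ᵐ[μ]
      ⋃ k : ℕ, {ω | ∃ i : Fin (k + 1), t < F ω (TopologicalSpace.denseSeq X i)} := by
    filter_upwards [hF] with ω hω ⟨x, hx⟩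
    obtain ⟨y, hy, k, rfl⟩ := (TopologicalSpace.denseRange_denseSeq X).inter_open_nonempty _
      (hω.isOpen_preimage t) ⟨x, hx⟩
    exact Set.mem_iUnion.2 ⟨k, Fin.last k, by simpa using hy⟩
  have hmono : Monotone fun k : ℕ =>
      {ω | ∃ i : Fin (k + 1), t < F ω (TopologicalSpace.denseSeq X i)} :=
    fun j k hjk ω ⟨i, hi⟩ => ⟨i.castLE (Nat.succ_le_succ hjk), hi⟩
  refine (measure_mono_ae hdense).trans ?_
  rw [hmono.measure_iUnion]
  exact iSup_le fun k => h k fun i => TopologicalSpace.denseSeq X i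

end SubGaussian

section Norms

variable {d : ℕ} {p q : ℝ≥0∞}

section Basic

variable [Fact (1 ≤ p)]

theorem vecNorm_nonneg (x : Fin d → ℝ) : 0 ≤ vecNorm p x :=
  norm_nonneg _

theorem vecNorm_smul (c : ℝ) (x : Fin d → ℝ) : vecNorm p (c • x) = |c| * vecNorm p x :=
  norm_smul c (WithLp.toLp p x)

theorem vecNorm_zero : vecNorm p (0 : Fin d → ℝ) = 0 :=
  norm_zero (E := PiLp p fun _ : Fin d => ℝ)

theorem vecNorm_neg (x : Fin d → ℝ) : vecNorm p (-x) = vecNorm p x :=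
  norm_neg (WithLp.toLp p x)

theorem vecNorm_add_le (x y : Fin d → ℝ) : vecNorm p (x + y) ≤ vecNorm p x + vecNorm p y :=
  norm_add_le (WithLp.toLp p x) (WithLp.toLp p y)

theorem abs_apply_le_vecNorm (x : Fin d → ℝ) (i : Fin d) : |x i| ≤ vecNorm p x :=
  PiLp.norm_apply_le (WithLp.toLp p x : PiLp p fun _ : Fin d => ℝ) i

theorem vecNorm_rpow (hp : p ≠ ∞) (x : Fin d → ℝ) :
    vecNorm p x ^ p.toReal = ∑ i, |x i| ^ p.toReal := by
  have hp0 : 0 < p.toReal := ENNReal.toReal_pos (zero_lt_one.trans_le Fact.out).ne' hp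
  rw [vecNorm, PiLp.norm_eq_sum hp0, ← Real.rpow_mul (by positivity), one_div,
    inv_mul_cancel₀ hp0.ne', Real.rpow_one]
  rfl

theorem vecNorm_two_sq (x : Fin d → ℝ) : vecNorm 2 x ^ 2 = ∑ i, x i ^ 2 := by
  simpa [vecNorm] using EuclideanSpace.norm_sq_eq (WithLp.toLp 2 x : EuclideanSpace ℝ (Fin d))

theorem isCompact_setOf_vecNorm_le (R : ℝ) : IsCompact {x : Fin d → ℝ | vecNorm p x ≤ R} := by
  have hball := (isCompact_closedBall (0 : PiLp p fun _ : Fin d => ℝ) R).image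
    (PiLp.continuous_ofLp p fun _ : Fin d => ℝ)
  convert hball using 1
  ext x
  simp only [Set.mem_ofPred_eq, Set.mem_image, Metric.mem_closedBall, dist_zero_right]
  exact ⟨fun hx => ⟨WithLp.toLp p x, hx, rfl⟩, by rintro ⟨y, hy, rfl⟩; exact hy⟩

end Basic

theorem continuous_vecNorm_two_sub (w : Fin d → ℝ) : Continuous fun v => vecNorm 2 (v - w) :=
  ((PiLp.continuous_toLp 2 fun _ : Fin d => ℝ).comp (continuous_sub_right w)).norm

theorem continuous_of_abs_sub_le_mul_vecNorm_two {f : (Fin d → ℝ) → ℝ} {C : ℝ}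
    (hf : ∀ v w, |f v - f w| ≤ C * vecNorm 2 (v - w)) : Continuous f := by
  refine continuous_iff_continuousAt.2 fun w => tendsto_iff_dist_tendsto_zero.2 ?_
  refine squeeze_zero (fun _ => dist_nonneg) (fun v => hf v w) ?_
  simpa [vecNorm_zero] using ((continuous_vecNorm_two_sub w).const_mul C).tendsto w

theorem abs_dotProduct_le (v x : Fin d → ℝ) : |v ⬝ᵥ x| ≤ vecNorm 2 v * vecNorm 2 x := by
  rw [dotProduct_comm]
  exact abs_real_inner_le_norm (WithLp.toLp 2 v : EuclideanSpace ℝ (Fin d)) (WithLp.toLp 2 x)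

section EuclideanFactor

theorem half_le_toReal_inv (hp0 : p ≠ 0) (hp : p ≤ 2) : 1 / 2 ≤ (p⁻¹).toReal := by
  simpa using ENNReal.toReal_mono (ENNReal.inv_ne_top.2 hp0) (ENNReal.inv_le_inv.2 hp)

theorem toReal_inv_le_half (hp : 2 ≤ p) : (p⁻¹).toReal ≤ 1 / 2 := by
  simpa using ENNReal.toReal_mono (by simp) (ENNReal.inv_le_inv.2 hp)

/-- The factor `d ^ max 0 (1/2 - 1/p)`, with `1/∞ = 0`: the norm of the identity of `ℝ^d` as an
operator from `ℓ_p` to `ℓ_2`. -/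
noncomputable def euclideanFactor (d : ℕ) (p : ℝ≥0∞) : ℝ :=
  (d : ℝ) ^ max 0 (1 / 2 - (p⁻¹).toReal)

theorem euclideanFactor_nonneg : 0 ≤ euclideanFactor d p :=
  Real.rpow_nonneg d.cast_nonneg _

theorem vecNorm_two_le_vecNorm [Fact (1 ≤ p)] (hp : p ≤ 2) (x : Fin d → ℝ) :
    vecNorm 2 x ≤ vecNorm p x := by
  have hp2 : p.toReal ≤ 2 := by simpa using ENNReal.toReal_mono (by simp) hp
  have hsplit : ∀ y : ℝ, 0 ≤ y → y ^ 2 = y ^ p.toReal * y ^ (2 - p.toReal) := by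
    intro y hy
    rw [← Real.rpow_add' hy (by norm_num), add_sub_cancel, Real.rpow_two]
  refine le_of_sq_le_sq ?_ (vecNorm_nonneg x)
  rw [vecNorm_two_sq, hsplit _ (vecNorm_nonneg x),
    vecNorm_rpow (hp.trans_lt (by simp)).ne, Finset.sum_mul]
  refine Finset.sum_le_sum fun i _ => ?_
  rw [← sq_abs, hsplit _ (abs_nonneg _)]
  gcongr
  exact abs_apply_le_vecNorm x i

theorem sum_sq_rpow_le [Fact (1 ≤ p)] (hp2 : 2 ≤ p) (hp : p ≠ ∞) (x : Fin d → ℝ) :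
    (∑ i, x i ^ 2) ^ (p.toReal / 2) ≤ (d : ℝ) ^ (p.toReal / 2 - 1) * vecNorm p x ^ p.toReal := by
  have hp2' : 2 ≤ p.toReal := by simpa using ENNReal.toReal_mono hp hp2
  have hpow : ∀ i, |x i ^ 2| ^ (p.toReal / 2) = |x i| ^ p.toReal := by
    intro i
    rw [abs_pow, ← Real.rpow_natCast, ← Real.rpow_mul (abs_nonneg _)]
    congr 1
    push_cast
    ring
  have h := Real.rpow_sum_le_const_mul_sum_rpow Finset.univ (fun i => x i ^ 2)
    (p := p.toReal / 2) (by linarith)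
  simp only [hpow, Finset.card_univ, Fintype.card_fin, ← vecNorm_rpow hp] at h
  simpa only [abs_of_nonneg (sq_nonneg (x _))] using h

theorem vecNorm_two_le_rpow_mul_vecNorm [Fact (1 ≤ p)] (hp2 : 2 ≤ p) (x : Fin d → ℝ) :
    vecNorm 2 x ≤ (d : ℝ) ^ (1 / 2 - (p⁻¹).toReal) * vecNorm p x := by
  have hx := vecNorm_nonneg (p := p) x
  have hd : (0 : ℝ) ≤ d := d.cast_nonneg
  refine le_of_sq_le_sq ?_ (by positivity)
  rw [vecNorm_two_sq, mul_pow, ← Real.rpow_mul_natCast hd]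
  rcases eq_or_ne p ∞ with rfl | hp
  · have hsq : ∀ i ∈ Finset.univ, x i ^ 2 ≤ vecNorm ∞ x ^ 2 := fun i _ => by
      rw [← sq_abs]
      exact pow_le_pow_left₀ (abs_nonneg _) (abs_apply_le_vecNorm x i) 2
    simpa using Finset.sum_le_sum hsq
  · have hp0 : 0 < p.toReal := ENNReal.toReal_pos (two_pos.trans_le hp2).ne' hp
    have hsum : 0 ≤ ∑ i, x i ^ 2 := Finset.sum_nonneg fun i _ => sq_nonneg _
    have h := Real.rpow_le_rpow (by positivity) (sum_sq_rpow_le hp2 hp x)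
      (by positivity : 0 ≤ 2 / p.toReal)
    rw [← Real.rpow_mul hsum, Real.mul_rpow (by positivity) (by positivity),
      ← Real.rpow_mul hd, ← Real.rpow_mul hx] at h
    have hone : p.toReal / 2 * (2 / p.toReal) = 1 := by field_simp
    have hexp : (p.toReal / 2 - 1) * (2 / p.toReal) = (1 / 2 - (p⁻¹).toReal) * (2 : ℕ) := by
      rw [ENNReal.toReal_inv]
      push_cast
      field_simp
    have htwo : p.toReal * (2 / p.toReal) = (2 : ℕ) := by
      push_cast
      field_simp
    rwa [hone, hexp, htwo, Real.rpow_one, Real.rpow_natCast] at h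

theorem vecNorm_two_le_euclideanFactor_mul [Fact (1 ≤ p)] (x : Fin d → ℝ) :
    vecNorm 2 x ≤ euclideanFactor d p * vecNorm p x := by
  rw [euclideanFactor]
  rcases le_total p 2 with hp | hp
  · have hhalf := half_le_toReal_inv (zero_lt_one.trans_le Fact.out).ne' hp
    rw [max_eq_left (by linarith), Real.rpow_zero, one_mul]
    exact vecNorm_two_le_vecNorm hp x
  · rw [max_eq_right (by linarith [toReal_inv_le_half hp])]
    exact vecNorm_two_le_rpow_mul_vecNorm hp x

theorem euclideanFactor_sq_le :
    euclideanFactor d q ^ 2 ≤ max 1 ((d : ℝ) ^ (1 - 2 * (q⁻¹).toReal)) := by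
  rw [euclideanFactor, ← Real.rpow_mul_natCast d.cast_nonneg]
  rcases le_total (1 / 2 - (q⁻¹).toReal) 0 with h | h
  · rw [max_eq_left h, zero_mul, Real.rpow_zero]
    exact le_max_left _ _
  · rw [max_eq_right h]
    refine (congrArg _ ?_).trans_le (le_max_right _ _)
    push_cast
    ring

theorem four_mul_euclideanFactor_sq_le_stepConst [Fact (1 ≤ p)] :
    4 * euclideanFactor d p ^ 2 ≤ stepConst d p := by
  rw [euclideanFactor, stepConst, ← Real.rpow_mul_natCast d.cast_nonneg]
  split_ifs with hp
  · have hhalf := half_le_toReal_inv (zero_lt_one.trans_le Fact.out).ne' hp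
    rw [max_eq_left (by linarith)]
    simp
  · have hpinv : (p⁻¹).toReal < 1 / 2 := by
      have h := ENNReal.toReal_strict_mono (by simp) (ENNReal.inv_lt_inv.2 (not_le.1 hp))
      simpa using h
    rw [max_eq_right (by linarith)]
    gcongr
    rcases d.eq_zero_or_pos with rfl | hd
    · rw [Nat.cast_zero, Real.zero_rpow (by push_cast; linarith)]
    · refine Real.rpow_le_self_of_one_le ?_ ?_
      · exact_mod_cast hd
      · push_cast
        linarith [ENNReal.toReal_nonneg (a := p⁻¹)]

theorem toReal_inv_add_toReal_inv (hpq : p⁻¹ + q⁻¹ = 1) : (p⁻¹).toReal + (q⁻¹).toReal = 1 := by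
  have hp : p⁻¹ ≠ ∞ := ne_top_of_le_ne_top ENNReal.one_ne_top (hpq ▸ le_self_add)
  have hq : q⁻¹ ≠ ∞ := ne_top_of_le_ne_top ENNReal.one_ne_top (hpq ▸ le_add_self)
  rw [← ENNReal.toReal_add hp hq, hpq, ENNReal.toReal_one]

theorem euclideanFactor_mul_euclideanFactor (hpq : p⁻¹ + q⁻¹ = 1) :
    euclideanFactor d p * euclideanFactor d q = dimFactor d q := by
  have hsum := toReal_inv_add_toReal_inv hpq
  rw [euclideanFactor, euclideanFactor, dimFactor, ← Real.rpow_add_of_nonneg d.cast_nonneg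
    (le_max_left _ _) (le_max_left _ _)]
  congr 1
  rcases le_total (q⁻¹).toReal (1 / 2) with h | h
  · rw [max_eq_left (by linarith), max_eq_right (by linarith), abs_of_nonpos (by linarith)]
    ring
  · rw [max_eq_right (by linarith), max_eq_left (by linarith), abs_of_nonneg (by linarith)]
    linarith

end EuclideanFactor

section DualNorm

/-- The norm dual to the `ℓ_p` norm. -/
noncomputable def dualNorm (p : ℝ≥0∞) (w : Fin d → ℝ) : ℝ :=
  sSup ((fun x => w ⬝ᵥ x) '' {x | vecNorm p x ≤ 1})

variable [Fact (1 ≤ p)]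

theorem isGreatest_dualNorm (w : Fin d → ℝ) :
    IsGreatest ((fun x => w ⬝ᵥ x) '' {x | vecNorm p x ≤ 1}) (dualNorm p w) :=
  ((isCompact_setOf_vecNorm_le 1).image (continuous_const.dotProduct continuous_id)).isGreatest_sSup
    ⟨_, 0, vecNorm_zero.trans_le zero_le_one, rfl⟩

theorem dotProduct_le_dualNorm (w : Fin d → ℝ) {x : Fin d → ℝ} (hx : vecNorm p x ≤ 1) :
    w ⬝ᵥ x ≤ dualNorm p w :=
  (isGreatest_dualNorm w).2 ⟨x, hx, rfl⟩

theorem exists_dotProduct_eq_dualNorm (w : Fin d → ℝ) :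
    ∃ x, vecNorm p x ≤ 1 ∧ w ⬝ᵥ x = dualNorm p w :=
  (isGreatest_dualNorm w).1

theorem dualNorm_zero : dualNorm p (0 : Fin d → ℝ) = 0 := by
  obtain ⟨x, -, hx⟩ := exists_dotProduct_eq_dualNorm (p := p) (0 : Fin d → ℝ)
  rw [← hx, zero_dotProduct]

theorem dotProduct_le_mul_dualNorm (w : Fin d → ℝ) {x : Fin d → ℝ} {R : ℝ}
    (hx : vecNorm p x ≤ R) : w ⬝ᵥ x ≤ R * dualNorm p w := by
  rcases ((vecNorm_nonneg x).trans hx).eq_or_lt with rfl | hR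
  · have hx0 : x = 0 := funext fun i => by simpa using (abs_apply_le_vecNorm x i).trans hx
    simp [hx0]
  · have hscaled : vecNorm p (R⁻¹ • x) ≤ 1 := by
      rwa [vecNorm_smul, abs_of_pos (inv_pos.2 hR), inv_mul_le_one₀ hR]
    have h := dotProduct_le_dualNorm w hscaled
    rwa [dotProduct_smul, smul_eq_mul, inv_mul_le_iff₀ hR] at h

theorem abs_dotProduct_le_mul_dualNorm (w : Fin d → ℝ) {x : Fin d → ℝ} {R : ℝ}
    (hx : vecNorm p x ≤ R) : |w ⬝ᵥ x| ≤ R * dualNorm p w := by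
  refine abs_le'.2 ⟨dotProduct_le_mul_dualNorm w hx, ?_⟩
  rw [← dotProduct_neg]
  exact dotProduct_le_mul_dualNorm w ((vecNorm_neg x).trans_le hx)

theorem dualNorm_sub_dualNorm_le (v w : Fin d → ℝ) :
    dualNorm p v - dualNorm p w ≤ euclideanFactor d p * vecNorm 2 (v - w) := by
  obtain ⟨x, hx, hvx⟩ := exists_dotProduct_eq_dualNorm (p := p) v
  calc dualNorm p v - dualNorm p w ≤ v ⬝ᵥ x - w ⬝ᵥ x := by
        linarith [dotProduct_le_dualNorm w hx]
    _ ≤ vecNorm 2 (v - w) * vecNorm 2 x := by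
        rw [← sub_dotProduct]
        exact (le_abs_self _).trans (abs_dotProduct_le _ _)
    _ ≤ vecNorm 2 (v - w) * euclideanFactor d p :=
        mul_le_mul_of_nonneg_left ((vecNorm_two_le_euclideanFactor_mul x).trans
          (mul_le_of_le_one_right euclideanFactor_nonneg hx)) (vecNorm_nonneg _)
    _ = _ := mul_comm _ _

theorem abs_dualNorm_sub_dualNorm_le (v w : Fin d → ℝ) :
    |dualNorm p v - dualNorm p w| ≤ euclideanFactor d p * vecNorm 2 (v - w) := by
  refine abs_sub_le_iff.2 ⟨dualNorm_sub_dualNorm_le v w, ?_⟩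
  rw [← vecNorm_neg, neg_sub]
  exact dualNorm_sub_dualNorm_le w v

end DualNorm

end Norms

section RobustLoss

variable {d n : ℕ} {p : ℝ≥0∞} {r : ℝ} {ℓ : ℝ → ℝ}

/-- The labelled examples considered here: the label is `±1` and the instance lies in the unit ball
of the `ℓ_p` norm. -/
def IsNormalizedExample (p : ℝ≥0∞) (z : (Fin d → ℝ) × ℝ) : Prop :=
  (z.2 = 1 ∨ z.2 = -1) ∧ vecNorm p z.1 ≤ 1

/-- The smallest margin `y ⟨w, x'⟩` over the `ℓ_p` ball of radius `r` around the instance of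
`z = (x, y)`, in closed form. -/
noncomputable def robustMargin (p : ℝ≥0∞) (r : ℝ) (w : Fin d → ℝ) (z : (Fin d → ℝ) × ℝ) : ℝ :=
  z.2 * (w ⬝ᵥ z.1) - r * dualNorm p w

/-- The robust loss averaged over the sample `S`. -/
noncomputable def empiricalRobustLoss (ℓ : ℝ → ℝ) (p : ℝ≥0∞) (r : ℝ)
    (S : Fin n → (Fin d → ℝ) × ℝ) (w : Fin d → ℝ) : ℝ :=
  (n : ℝ)⁻¹ * ∑ i, robustLoss ℓ p r w (S i)

theorem IsNormalizedExample.abs_snd {z : (Fin d → ℝ) × ℝ} (hz : IsNormalizedExample p z) :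
    |z.2| = 1 :=
  (abs_eq zero_le_one).2 hz.1

theorem measurable_robustMargin (w : Fin d → ℝ) : Measurable (robustMargin p r w) := by
  unfold robustMargin dotProduct
  fun_prop

theorem measurable_comp_robustMargin (hlip : LipschitzWith 1 ℓ) (w : Fin d → ℝ) :
    Measurable fun z => ℓ (robustMargin p r w z) :=
  hlip.continuous.measurable.comp (measurable_robustMargin w)

variable [Fact (1 ≤ p)]

theorem IsNormalizedExample.vecNorm_two_le {z : (Fin d → ℝ) × ℝ} (hz : IsNormalizedExample p z) :
    vecNorm 2 z.1 ≤ euclideanFactor d p :=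
  (vecNorm_two_le_euclideanFactor_mul z.1).trans
    (mul_le_of_le_one_right euclideanFactor_nonneg hz.2)

theorem IsNormalizedExample.abs_mul_dotProduct_le {z : (Fin d → ℝ) × ℝ}
    (hz : IsNormalizedExample p z) (w : Fin d → ℝ) :
    |z.2 * (w ⬝ᵥ z.1)| ≤ euclideanFactor d p * vecNorm 2 w := by
  rw [abs_mul, hz.abs_snd, one_mul, mul_comm]
  exact (abs_dotProduct_le w z.1).trans
    (mul_le_mul_of_nonneg_left hz.vecNorm_two_le (vecNorm_nonneg w))

theorem robustMargin_zero (z : (Fin d → ℝ) × ℝ) : robustMargin p r 0 z = 0 := by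
  simp [robustMargin, dualNorm_zero]

theorem robustMargin_le (w : Fin d → ℝ) {z : (Fin d → ℝ) × ℝ} (hz : z.2 = 1 ∨ z.2 = -1)
    {x : Fin d → ℝ} (hx : x ∈ lpBall p z.1 r) : robustMargin p r w z ≤ z.2 * (w ⬝ᵥ x) := by
  have h := abs_le.1 (abs_dotProduct_le_mul_dualNorm w hx)
  rw [dotProduct_sub] at h
  unfold robustMargin
  rcases hz with hy | hy <;> rw [hy] <;> linarith

theorem exists_robustMargin_eq (hr : 0 ≤ r) (w : Fin d → ℝ) {z : (Fin d → ℝ) × ℝ}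
    (hz : z.2 = 1 ∨ z.2 = -1) : ∃ x ∈ lpBall p z.1 r, z.2 * (w ⬝ᵥ x) = robustMargin p r w z := by
  obtain ⟨v, hv, hwv⟩ := exists_dotProduct_eq_dualNorm (p := p) w
  have hy : |z.2| = 1 := (abs_eq zero_le_one).2 hz
  have hyy : z.2 * z.2 = 1 := by rw [← abs_mul_abs_self, hy, one_mul]
  refine ⟨z.1 - (z.2 * r) • v, ?_, ?_⟩
  · rw [lpBall, Set.mem_ofPred_eq, sub_sub_cancel, vecNorm_smul, abs_mul, hy, one_mul,
      abs_of_nonneg hr]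
    exact mul_le_of_le_one_right hr hv
  · rw [dotProduct_sub, dotProduct_smul, hwv, robustMargin, smul_eq_mul]
    linear_combination (-r * dualNorm p w) * hyy

theorem isGreatest_robustLoss (hdec : Antitone ℓ) (hr : 0 ≤ r) (w : Fin d → ℝ)
    {z : (Fin d → ℝ) × ℝ} (hz : z.2 = 1 ∨ z.2 = -1) :
    IsGreatest ((fun x => ℓ (z.2 * (w ⬝ᵥ x))) '' lpBall p z.1 r) (ℓ (robustMargin p r w z)) := by
  obtain ⟨x, hx, h⟩ := exists_robustMargin_eq (p := p) hr w hz
  exact ⟨⟨x, hx, congrArg ℓ h⟩, Set.forall_mem_image.2 fun y hy => hdec (robustMargin_le w hz hy)⟩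

theorem robustLoss_eq (hdec : Antitone ℓ) (hr : 0 ≤ r) (w : Fin d → ℝ) {z : (Fin d → ℝ) × ℝ}
    (hz : z.2 = 1 ∨ z.2 = -1) : robustLoss ℓ p r w z = ℓ (robustMargin p r w z) :=
  (isGreatest_robustLoss hdec hr w hz).csSup_eq

theorem abs_robustMargin_sub_le (hr : 0 ≤ r) (v w : Fin d → ℝ) {z : (Fin d → ℝ) × ℝ}
    (hz : IsNormalizedExample p z) :
    |robustMargin p r v z - robustMargin p r w z| ≤
      (1 + r) * euclideanFactor d p * vecNorm 2 (v - w) := by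
  calc |robustMargin p r v z - robustMargin p r w z|
      = |z.2 * ((v - w) ⬝ᵥ z.1) - r * (dualNorm p v - dualNorm p w)| := by
        rw [robustMargin, robustMargin, sub_dotProduct]
        ring_nf
    _ ≤ |z.2 * ((v - w) ⬝ᵥ z.1)| + r * |dualNorm p v - dualNorm p w| := by
        rw [← abs_of_nonneg hr, ← abs_mul, abs_of_nonneg hr]
        exact abs_sub _ _
    _ ≤ euclideanFactor d p * vecNorm 2 (v - w) + r * (euclideanFactor d p * vecNorm 2 (v - w)) :=
        add_le_add (hz.abs_mul_dotProduct_le _)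
          (mul_le_mul_of_nonneg_left (abs_dualNorm_sub_dualNorm_le v w) hr)
    _ = (1 + r) * euclideanFactor d p * vecNorm 2 (v - w) := by ring

theorem abs_robustLoss_sub_le (hdec : Antitone ℓ) (hlip : LipschitzWith 1 ℓ) (hr : 0 ≤ r)
    (v w : Fin d → ℝ) {z : (Fin d → ℝ) × ℝ} (hz : IsNormalizedExample p z) :
    |robustLoss ℓ p r v z - robustLoss ℓ p r w z| ≤
      (1 + r) * euclideanFactor d p * vecNorm 2 (v - w) := by
  rw [robustLoss_eq hdec hr v hz.1, robustLoss_eq hdec hr w hz.1]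
  exact ((hlip.dist_le_mul _ _).trans_eq (one_mul _)).trans (abs_robustMargin_sub_le hr v w hz)

theorem continuous_empiricalRobustLoss (hdec : Antitone ℓ) (hlip : LipschitzWith 1 ℓ) (hr : 0 ≤ r)
    {S : Fin n → (Fin d → ℝ) × ℝ} (hS : ∀ i, IsNormalizedExample p (S i)) :
    Continuous (empiricalRobustLoss ℓ p r S) := by
  have hcont : ∀ i, Continuous fun w => robustLoss ℓ p r w (S i) := fun i =>
    continuous_of_abs_sub_le_mul_vecNorm_two fun v w =>
      abs_robustLoss_sub_le hdec hlip hr v w (hS i)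
  exact (continuous_finsetSum _ fun i _ => hcont i).const_mul _

section Population

variable {D : Measure ((Fin d → ℝ) × ℝ)}

theorem robustLoss_ae_eq (hdec : Antitone ℓ) (hr : 0 ≤ r) (hD : ∀ᵐ z ∂D, IsNormalizedExample p z)
    (w : Fin d → ℝ) : robustLoss ℓ p r w =ᵐ[D] fun z => ℓ (robustMargin p r w z) := by
  filter_upwards [hD] with z hz using robustLoss_eq hdec hr w hz.1

theorem integrable_robustLoss [IsFiniteMeasure D] (hdec : Antitone ℓ) (hlip : LipschitzWith 1 ℓ)
    (hr : 0 ≤ r) (hD : ∀ᵐ z ∂D, IsNormalizedExample p z) (w : Fin d → ℝ) :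
    Integrable (robustLoss ℓ p r w) D := by
  refine Integrable.of_bound ((measurable_comp_robustMargin hlip w).aestronglyMeasurable.congr
    (robustLoss_ae_eq hdec hr hD w).symm) (|ℓ 0| + (1 + r) * euclideanFactor d p * vecNorm 2 w) ?_
  filter_upwards [hD] with z hz
  have h := abs_robustLoss_sub_le hdec hlip hr w 0 hz
  rw [robustLoss_eq hdec hr 0 hz.1, robustMargin_zero, sub_zero] at h
  rw [Real.norm_eq_abs]
  linarith [abs_sub_abs_le_abs_sub (robustLoss ℓ p r w z) (ℓ 0)]

variable [IsProbabilityMeasure D]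

theorem continuous_populationRobustLoss (hdec : Antitone ℓ) (hlip : LipschitzWith 1 ℓ)
    (hr : 0 ≤ r) (hD : ∀ᵐ z ∂D, IsNormalizedExample p z) :
    Continuous (populationRobustLoss ℓ p r D) := by
  refine continuous_of_abs_sub_le_mul_vecNorm_two (C := (1 + r) * euclideanFactor d p)
    fun v w => ?_
  rw [populationRobustLoss, populationRobustLoss, ← Real.norm_eq_abs,
    ← integral_sub (integrable_robustLoss hdec hlip hr hD v)
      (integrable_robustLoss hdec hlip hr hD w)]
  refine (norm_integral_le_of_norm_le_const ?_).trans_eq (by rw [probReal_univ, mul_one])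
  filter_upwards [hD] with z hz using abs_robustLoss_sub_le hdec hlip hr v w hz

theorem populationRobustLoss_zero_le_add (hdec : Antitone ℓ) (hlip : LipschitzWith 1 ℓ)
    (hr : 0 ≤ r) (hD : ∀ᵐ z ∂D, IsNormalizedExample p z) {w : Fin d → ℝ} {c : ℝ} (hc : 0 ≤ c)
    (hw : ∀ᵐ z ∂D, robustMargin p r w z ≤ c) :
    populationRobustLoss ℓ p r D 0 ≤ populationRobustLoss ℓ p r D w + c := by
  have hint := integrable_robustLoss hdec hlip hr hD
  calc populationRobustLoss ℓ p r D 0 ≤ ∫ z, (robustLoss ℓ p r w z + c) ∂D := by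
        refine integral_mono_ae (hint 0) ((hint w).add (integrable_const c)) ?_
        filter_upwards [hD, hw] with z hz hwz
        have hℓc := (hlip.dist_le_mul 0 c).trans_eq (one_mul _)
        rw [Real.dist_eq, Real.dist_eq, zero_sub, abs_neg, abs_of_nonneg hc] at hℓc
        rw [robustLoss_eq hdec hr 0 hz.1, robustLoss_eq hdec hr w hz.1, robustMargin_zero]
        linarith [le_abs_self (ℓ 0 - ℓ c), hdec hwz]
    _ = populationRobustLoss ℓ p r D w + c := by
        rw [integral_add (hint w) (integrable_const c), integral_const, probReal_univ, one_smul,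
          populationRobustLoss]

theorem populationRobustLoss_zero_le_of_one_le (hdec : Antitone ℓ) (hlip : LipschitzWith 1 ℓ)
    (hr : 1 ≤ r) (hD : ∀ᵐ z ∂D, IsNormalizedExample p z) (w : Fin d → ℝ) :
    populationRobustLoss ℓ p r D 0 ≤ populationRobustLoss ℓ p r D w := by
  refine (populationRobustLoss_zero_le_add hdec hlip (zero_le_one.trans hr) hD le_rfl ?_).trans_eq
    (add_zero _)
  filter_upwards [hD] with z hz
  have hzero : (0 : Fin d → ℝ) ∈ lpBall p z.1 r := by
    simpa [lpBall] using hz.2.trans hr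
  simpa using robustMargin_le w hz.1 hzero

theorem populationRobustLoss_zero_le (hdec : Antitone ℓ) (hlip : LipschitzWith 1 ℓ)
    (hr : 0 ≤ r) (hD : ∀ᵐ z ∂D, IsNormalizedExample p z) (w : Fin d → ℝ) :
    populationRobustLoss ℓ p r D 0 ≤
      populationRobustLoss ℓ p r D w + euclideanFactor d p * vecNorm 2 w := by
  refine populationRobustLoss_zero_le_add hdec hlip hr hD
    (mul_nonneg euclideanFactor_nonneg (vecNorm_nonneg w)) ?_
  filter_upwards [hD] with z hz
  have hcentre : z.1 ∈ lpBall p z.1 r := by simpa [lpBall, vecNorm_zero] using hr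
  exact (robustMargin_le w hz.1 hcentre).trans
    ((le_abs_self _).trans (hz.abs_mul_dotProduct_le w))

end Population

end RobustLoss

section GradientDescent

theorem exists_iterate_le_of_subgradient_step {E : Type*} [NormedAddCommGroup E]
    [InnerProductSpace ℝ E] {w G : ℕ → E} {f : ℕ → ℝ} {a : E} {η ε L K : ℝ} (hη : 0 < η)
    (hε : 0 < ε) (hstep : ∀ k, w (k + 1) = w k - η • G k)
    (hf : ∀ k, f k ≤ inner ℝ (w k - a) (G k)) (hG : ∀ k, ‖G k‖ ≤ L) (hL : η * L ^ 2 ≤ ε)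
    (hK : ‖w 0 - a‖ ^ 2 ≤ K * (η * ε)) :
    ∃ k : ℕ, (k : ℝ) ≤ K ∧ f k ≤ ε ∧ ‖w k - a‖ ≤ ‖w 0 - a‖ := by
  have hηε : 0 < η * ε := mul_pos hη hε
  have hK0 : 0 ≤ K := nonneg_of_mul_nonneg_left ((sq_nonneg _).trans hK) hηε
  have hdescent : ∀ k, ε < f k → ‖w (k + 1) - a‖ ^ 2 ≤ ‖w k - a‖ ^ 2 - η * ε := by
    intro k hk
    have hGsq : η * ‖G k‖ ^ 2 ≤ ε :=
      (mul_le_mul_of_nonneg_left (pow_le_pow_left₀ (norm_nonneg _) (hG k) 2) hη.le).trans hL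
    have hexpand : ‖w (k + 1) - a‖ ^ 2 =
        ‖w k - a‖ ^ 2 - η * (2 * inner ℝ (w k - a) (G k) - η * ‖G k‖ ^ 2) := by
      rw [hstep, sub_right_comm, norm_sub_sq_real, real_inner_smul_right, norm_smul,
        Real.norm_of_nonneg hη.le]
      ring
    rw [hexpand]
    have hgain : ε ≤ 2 * inner ℝ (w k - a) (G k) - η * ‖G k‖ ^ 2 := by linarith [hf k]
    linarith [mul_le_mul_of_nonneg_left hgain hη.le]
  by_contra! hfail
  have hdist : ∀ k : ℕ, (k : ℝ) ≤ K + 1 → ‖w k - a‖ ^ 2 ≤ ‖w 0 - a‖ ^ 2 - k * (η * ε) := by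
    intro k
    induction k with
    | zero => simp
    | succ k ih =>
      intro hk
      push_cast at hk ⊢
      have hk' := ih (by linarith)
      have hnear : ‖w k - a‖ ≤ ‖w 0 - a‖ := by
        refine le_of_sq_le_sq ?_ (norm_nonneg _)
        have : 0 ≤ (k : ℝ) * (η * ε) := by positivity
        linarith
      have hlarge : ε < f k := by
        by_contra! hsmall
        exact (hfail k (by linarith) hsmall).not_ge hnear
      linarith [hdescent k hlarge]
  have hlast := hdist (⌊K⌋₊ + 1) (by push_cast; linarith [Nat.floor_le hK0])
  have hfloor := mul_lt_mul_of_pos_right (Nat.lt_floor_add_one K) hηε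
  push_cast at hlast
  linarith [sq_nonneg ‖w (⌊K⌋₊ + 1) - a‖]

variable {d n : ℕ} {p : ℝ≥0∞} {r : ℝ} {ℓ g : ℝ → ℝ}

theorem IsSubgradientSelection.abs_le {K : NNReal} (hg : IsSubgradientSelection ℓ g)
    (hlip : LipschitzWith K ℓ) (z : ℝ) : |g z| ≤ K := by
  have hstep : ∀ u, |u - z| = 1 → g z * (u - z) ≤ K := by
    intro u hu
    have h := hlip.dist_le_mul u z
    rw [Real.dist_eq, Real.dist_eq, hu, mul_one] at h
    linarith [hg z u, le_abs_self (ℓ u - ℓ z)]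
  refine abs_le'.2 ⟨?_, ?_⟩
  · simpa using hstep (z + 1) (by simp)
  · simpa using hstep (z - 1) (by simp)

/-- The gradient in `w` of `ℓ (y ⟨w, x + δ⟩)` at the labelled example `z = (x, y)`, where `g` is the
derivative of `ℓ` and the perturbation `δ` is treated as a constant. -/
def perturbedGradient (g : ℝ → ℝ) (w : Fin d → ℝ) (z : (Fin d → ℝ) × ℝ) (δ : Fin d → ℝ) :
    Fin d → ℝ :=
  (g (z.2 * (w ⬝ᵥ (z.1 + δ))) * z.2) • (z.1 + δ)

variable [Fact (1 ≤ p)]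

theorem robustLoss_sub_le_dotProduct_perturbedGradient (hdec : Antitone ℓ)
    (hg : IsSubgradientSelection ℓ g) {w : Fin d → ℝ} {z : (Fin d → ℝ) × ℝ} {δ : Fin d → ℝ}
    (hz : z.2 = 1 ∨ z.2 = -1) (hδ : IsWorstPerturbation ℓ p r w z δ) (v : Fin d → ℝ) :
    robustLoss ℓ p r w z - robustLoss ℓ p r v z ≤ (w - v) ⬝ᵥ perturbedGradient g w z δ := by
  have hr : 0 ≤ r := (vecNorm_nonneg δ).trans hδ.1
  have hworst : robustLoss ℓ p r w z ≤ ℓ (z.2 * (w ⬝ᵥ (z.1 + δ))) := by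
    obtain ⟨x, hx, hmargin⟩ := exists_robustMargin_eq (p := p) hr w hz
    have h := hδ.2 (x - z.1) (by rw [← neg_sub, vecNorm_neg]; exact hx)
    rwa [add_sub_cancel, hmargin, ← robustLoss_eq hdec hr w hz] at h
  have hball : z.1 + δ ∈ lpBall p z.1 r := by
    rw [lpBall, Set.mem_ofPred_eq, sub_add_cancel_left, vecNorm_neg]
    exact hδ.1
  have hfeasible : ℓ (z.2 * (v ⬝ᵥ (z.1 + δ))) ≤ robustLoss ℓ p r v z := by
    rw [robustLoss_eq hdec hr v hz]
    exact hdec (robustMargin_le v hz hball)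
  have hsubgradient := hg (z.2 * (w ⬝ᵥ (z.1 + δ))) (z.2 * (v ⬝ᵥ (z.1 + δ)))
  rw [perturbedGradient, dotProduct_smul, sub_dotProduct, smul_eq_mul]
  linarith

theorem vecNorm_two_perturbedGradient_le (hlip : LipschitzWith 1 ℓ)
    (hg : IsSubgradientSelection ℓ g) (w : Fin d → ℝ) {z : (Fin d → ℝ) × ℝ} {δ : Fin d → ℝ}
    (hz : IsNormalizedExample p z) (hδ : vecNorm p δ ≤ r) :
    vecNorm 2 (perturbedGradient g w z δ) ≤ (1 + r) * euclideanFactor d p := by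
  have hx : vecNorm p (z.1 + δ) ≤ 1 + r := (vecNorm_add_le _ _).trans (add_le_add hz.2 hδ)
  rw [perturbedGradient, vecNorm_smul, abs_mul, hz.abs_snd, mul_one, mul_comm (1 + r)]
  exact (mul_le_of_le_one_left (vecNorm_nonneg _) (hg.abs_le hlip _)).trans
    ((vecNorm_two_le_euclideanFactor_mul _).trans
      (mul_le_mul_of_nonneg_left hx euclideanFactor_nonneg))

theorem exists_iterate_empiricalRobustLoss_le (hn : 0 < n) (hdec : Antitone ℓ)
    (hlip : LipschitzWith 1 ℓ) (hg : IsSubgradientSelection ℓ g)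
    {S : Fin n → (Fin d → ℝ) × ℝ} (hS : ∀ i, IsNormalizedExample p (S i)) {η ε K : ℝ}
    (hη : 0 < η) (hε : 0 < ε) (hηε : η * ((1 + r) * euclideanFactor d p) ^ 2 ≤ ε)
    {w : ℕ → Fin d → ℝ} (hw : IsAdversarialTrainingRun ℓ g p r η S w) {v : Fin d → ℝ}
    (hK : vecNorm 2 (w 0 - v) ^ 2 ≤ K * (η * ε)) :
    ∃ k : ℕ, (k : ℝ) ≤ K ∧ empiricalRobustLoss ℓ p r S (w k) ≤ empiricalRobustLoss ℓ p r S v + ε ∧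
      vecNorm 2 (w k - v) ≤ vecNorm 2 (w 0 - v) := by
  choose δ hδ hstep using hw
  let grad : ℕ → Fin n → EuclideanSpace ℝ (Fin d) := fun k i =>
    WithLp.toLp 2 (perturbedGradient g (w k) (S i) (δ k i))
  have hiter : ∀ k, (WithLp.toLp 2 (w (k + 1)) : EuclideanSpace ℝ (Fin d)) =
      WithLp.toLp 2 (w k) - η • (n : ℝ)⁻¹ • ∑ i, grad k i := by
    intro k
    rw [hstep, smul_smul, ← div_eq_mul_inv, ← WithLp.toLp_sum, ← WithLp.toLp_smul,
      ← WithLp.toLp_sub]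
    rfl
  have hlin : ∀ k, empiricalRobustLoss ℓ p r S (w k) - empiricalRobustLoss ℓ p r S v ≤
      inner ℝ (WithLp.toLp 2 (w k) - WithLp.toLp 2 v) ((n : ℝ)⁻¹ • ∑ i, grad k i) := by
    intro k
    rw [empiricalRobustLoss, empiricalRobustLoss, ← mul_sub, ← Finset.sum_sub_distrib,
      real_inner_smul_right, inner_sum]
    gcongr with i
    rw [← WithLp.toLp_sub, EuclideanSpace.inner_toLp_toLp, dotProduct_comm]
    exact robustLoss_sub_le_dotProduct_perturbedGradient hdec hg (hS i).1 (hδ k i) v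
  have hbound : ∀ k, ‖(n : ℝ)⁻¹ • ∑ i, grad k i‖ ≤ (1 + r) * euclideanFactor d p := by
    intro k
    rw [norm_smul, norm_inv, Real.norm_natCast, inv_mul_le_iff₀ (by positivity)]
    refine (norm_sum_le_of_le _ fun i _ =>
      vecNorm_two_perturbedGradient_le hlip hg (w k) (hS i) (hδ k i).1).trans_eq ?_
    rw [Finset.sum_const, Finset.card_univ, Fintype.card_fin, nsmul_eq_mul]
  obtain ⟨k, hkK, hk, hnear⟩ :=
    exists_iterate_le_of_subgradient_step hη hε hiter hlin hbound hηε hK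
  exact ⟨k, hkK, sub_le_iff_le_add'.1 hk, hnear⟩

end GradientDescent

section UniformDeviation

variable {d n : ℕ} {p : ℝ≥0∞} {r : ℝ} {ℓ : ℝ → ℝ}

theorem norm_withLp_two_prod_le {α β : Type*} [SeminormedAddCommGroup α]
    [SeminormedAddCommGroup β] (x : WithLp 2 (α × β)) : ‖x‖ ≤ ‖x.fst‖ + ‖x.snd‖ := by
  rw [WithLp.prod_norm_eq_of_L2, Real.sqrt_le_iff]
  refine ⟨by positivity, ?_⟩
  linarith [add_sq ‖x.fst‖ ‖x.snd‖, mul_nonneg (norm_nonneg x.fst) (norm_nonneg x.snd)]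

theorem ae_pi_isNormalizedExample {D : Measure ((Fin d → ℝ) × ℝ)} [IsProbabilityMeasure D]
    (hD : ∀ᵐ z ∂D, IsNormalizedExample p z) :
    ∀ᵐ S ∂(Measure.pi fun _ : Fin n => D), ∀ i, IsNormalizedExample p (S i) :=
  ae_all_iff.2 fun i =>
    (measurePreserving_eval (fun _ : Fin n => D) i).quasiMeasurePreserving.ae hD

/-- The predictor `v` as a vector of a Euclidean space in which its robust margin relative to the
comparator `a` is linear: the extra coordinate carries the dual norms, and the scaling `m` balances
the two coordinates. -/
noncomputable def marginVector (p : ℝ≥0∞) (m : ℝ) (a v : Fin d → ℝ) :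
    WithLp 2 (EuclideanSpace ℝ (Fin d) × ℝ) :=
  WithLp.toLp 2 (WithLp.toLp 2 (v - a), m⁻¹ * (dualNorm p v - dualNorm p a))

/-- The labelled example `z` as the vector of the same space with which the robust margin is the
inner product. -/
noncomputable def marginFeature (r m : ℝ) (z : (Fin d → ℝ) × ℝ) :
    WithLp 2 (EuclideanSpace ℝ (Fin d) × ℝ) :=
  WithLp.toLp 2 (WithLp.toLp 2 (z.2 • z.1), -(m * r))

theorem inner_marginVector_marginFeature {m : ℝ} (hm : m ≠ 0) (a v : Fin d → ℝ)
    (z : (Fin d → ℝ) × ℝ) :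
    inner ℝ (marginVector p m a v) (marginFeature r m z) =
      robustMargin p r v z - robustMargin p r a z := by
  simp only [marginVector, marginFeature, WithLp.prod_inner_apply,
    EuclideanSpace.inner_toLp_toLp, robustMargin, star_trivial, smul_dotProduct, smul_eq_mul,
    dotProduct_sub, dotProduct_comm z.1, RCLike.inner_apply, conj_trivial]
  field_simp
  ring

variable [Fact (1 ≤ p)]

theorem norm_marginVector_le (hm : 0 < euclideanFactor d p) (a v : Fin d → ℝ) :
    ‖marginVector p (euclideanFactor d p) a v‖ ≤ 2 * vecNorm 2 (v - a) := by
  have hdual : ‖(euclideanFactor d p)⁻¹ * (dualNorm p v - dualNorm p a)‖ ≤ vecNorm 2 (v - a) := by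
    rw [norm_mul, norm_inv, Real.norm_of_nonneg hm.le, inv_mul_le_iff₀ hm]
    exact abs_dualNorm_sub_dualNorm_le v a
  rw [two_mul]
  exact (norm_withLp_two_prod_le _).trans (add_le_add le_rfl hdual)

theorem norm_marginFeature_le (hr : 0 ≤ r) {z : (Fin d → ℝ) × ℝ} (hz : IsNormalizedExample p z) :
    ‖marginFeature r (euclideanFactor d p) z‖ ≤ (1 + r) * euclideanFactor d p := by
  have hfst : vecNorm 2 (z.2 • z.1) ≤ euclideanFactor d p := by
    rw [vecNorm_smul, hz.abs_snd, one_mul]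
    exact hz.vecNorm_two_le
  have hsnd : ‖-(euclideanFactor d p * r)‖ = r * euclideanFactor d p := by
    rw [norm_neg, Real.norm_of_nonneg (mul_nonneg euclideanFactor_nonneg hr), mul_comm]
  rw [add_mul, one_mul]
  exact (norm_withLp_two_prod_le _).trans (add_le_add hfst hsnd.le)

variable {D : Measure ((Fin d → ℝ) × ℝ)} [IsProbabilityMeasure D]

theorem natCast_mul_robustLoss_deviation_eq_sum (hn : 0 < n) (hdec : Antitone ℓ)
    (hlip : LipschitzWith 1 ℓ) (hr : 0 ≤ r) (hD : ∀ᵐ z ∂D, IsNormalizedExample p z)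
    {S : Fin n → (Fin d → ℝ) × ℝ} (hS : ∀ k, IsNormalizedExample p (S k)) (v a : Fin d → ℝ) :
    n * ((populationRobustLoss ℓ p r D v - populationRobustLoss ℓ p r D a)
        - (empiricalRobustLoss ℓ p r S v - empiricalRobustLoss ℓ p r S a)) =
      ∑ k, (∫ z, (ℓ (robustMargin p r v z) - ℓ (robustMargin p r a z)) ∂D
        - (ℓ (robustMargin p r v (S k)) - ℓ (robustMargin p r a (S k)))) := by
  have hn0 : (n : ℝ) ≠ 0 := by exact_mod_cast hn.ne'
  have hmean : ∫ z, (ℓ (robustMargin p r v z) - ℓ (robustMargin p r a z)) ∂D =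
      populationRobustLoss ℓ p r D v - populationRobustLoss ℓ p r D a := by
    rw [populationRobustLoss, populationRobustLoss,
      ← integral_sub (integrable_robustLoss hdec hlip hr hD v)
        (integrable_robustLoss hdec hlip hr hD a)]
    exact integral_congr_ae ((robustLoss_ae_eq hdec hr hD v).sub
      (robustLoss_ae_eq hdec hr hD a)).symm
  have hsample : ∀ w, n * empiricalRobustLoss ℓ p r S w = ∑ k, ℓ (robustMargin p r w (S k)) := by
    intro w
    rw [empiricalRobustLoss, mul_inv_cancel_left₀ hn0]
    exact Finset.sum_congr rfl fun k _ => robustLoss_eq hdec hr w (hS k).1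
  rw [hmean, Finset.sum_sub_distrib, Finset.sum_const, Finset.card_univ, Fintype.card_fin,
    nsmul_eq_mul, Finset.sum_sub_distrib, ← hsample, ← hsample]
  ring

theorem measure_pi_exists_lt_robustLoss_deviation_le {ι : Type*} [Finite ι] [Nonempty ι]
    (hn : 0 < n) (hdec : Antitone ℓ) (hlip : LipschitzWith 1 ℓ) (hr : 0 ≤ r)
    (hD : ∀ᵐ z ∂D, IsNormalizedExample p z) (hm : 0 < euclideanFactor d p) {a : Fin d → ℝ} {A : ℝ}
    (hA : 0 < A) {u : ι → Fin d → ℝ} (hu : ∀ i, vecNorm 2 (u i - a) ≤ A) {t : ℝ} (ht : 0 ≤ t) :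
    (Measure.pi fun _ : Fin n => D)
      {S | ∃ i, t < (populationRobustLoss ℓ p r D (u i) - populationRobustLoss ℓ p r D a)
        - (empiricalRobustLoss ℓ p r S (u i) - empiricalRobustLoss ℓ p r S a)} ≤
      ENNReal.ofReal (2 * Real.exp
        (-(n * t ^ 2 / (8 * (2 * A * ((1 + r) * euclideanFactor d p)) ^ 2)))) := by
  have hcontr : ∀ z, IsContraction
      (fun i => ℓ (robustMargin p r (u i) z) - ℓ (robustMargin p r a z)) fun i =>
        inner ℝ (marginVector p (euclideanFactor d p) a (u i))
          (marginFeature r (euclideanFactor d p) z) := by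
    intro z
    simp only [inner_marginVector_marginFeature hm.ne']
    refine ⟨fun i => (hlip.dist_le_mul _ _).trans_eq (one_mul _), fun i j => ?_⟩
    rw [sub_sub_sub_cancel_right, sub_sub_sub_cancel_right]
    exact (hlip.dist_le_mul _ _).trans_eq (one_mul _)
  refine (measure_mono_ae ?_).trans (measure_pi_exists_le_sum_le (D := D)
    (fun i => marginVector p (euclideanFactor d p) a (u i))
    (fun i => (norm_marginVector_le hm a (u i)).trans
      (mul_le_mul_of_nonneg_left (hu i) zero_le_two))
    (marginFeature r (euclideanFactor d p)) (hD.mono fun z hz => norm_marginFeature_le hr hz)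
    (fun i => by
      simp only [inner_marginVector_marginFeature hm.ne']
      exact (measurable_robustMargin _).sub (measurable_robustMargin _))
    (h := fun i z => ℓ (robustMargin p r (u i) z) - ℓ (robustMargin p r a z))
    (fun i => (measurable_comp_robustMargin hlip _).sub (measurable_comp_robustMargin hlip _))
    hcontr (by positivity) n ht)
  filter_upwards [ae_pi_isNormalizedExample hD] with S hS ⟨i, hi⟩
  refine ⟨i, ?_⟩
  rw [← natCast_mul_robustLoss_deviation_eq_sum hn hdec hlip hr hD hS]
  exact mul_le_mul_of_nonneg_left hi.le n.cast_nonneg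

theorem measure_pi_exists_mem_ball_lt_robustLoss_deviation_le (hn : 0 < n) (hdec : Antitone ℓ)
    (hlip : LipschitzWith 1 ℓ) (hr : 0 ≤ r) (hD : ∀ᵐ z ∂D, IsNormalizedExample p z)
    (hm : 0 < euclideanFactor d p) (a : Fin d → ℝ) {A : ℝ} (hA : 0 < A) {t : ℝ} (ht : 0 ≤ t) :
    (Measure.pi fun _ : Fin n => D)
      {S | ∃ v, vecNorm 2 (v - a) ≤ A ∧
        t < (populationRobustLoss ℓ p r D v - populationRobustLoss ℓ p r D a)
          - (empiricalRobustLoss ℓ p r S v - empiricalRobustLoss ℓ p r S a)} ≤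
      ENNReal.ofReal (2 * Real.exp
        (-(n * t ^ 2 / (8 * (2 * A * ((1 + r) * euclideanFactor d p)) ^ 2)))) := by
  have hnonempty : Nonempty {v : Fin d → ℝ // vecNorm 2 (v - a) ≤ A} :=
    ⟨a, by rw [sub_self, vecNorm_zero]; exact hA.le⟩
  have hcont : ∀ᵐ S ∂(Measure.pi fun _ : Fin n => D),
      LowerSemicontinuous fun v : {v : Fin d → ℝ // vecNorm 2 (v - a) ≤ A} =>
        (populationRobustLoss ℓ p r D v - populationRobustLoss ℓ p r D a)
          - (empiricalRobustLoss ℓ p r S v - empiricalRobustLoss ℓ p r S a) := by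
    filter_upwards [ae_pi_isNormalizedExample hD] with S hS
    exact ((((continuous_populationRobustLoss hdec hlip hr hD).sub continuous_const).sub
      ((continuous_empiricalRobustLoss hdec hlip hr hS).sub continuous_const)).comp
        continuous_subtype_val).lowerSemicontinuous
  refine (measure_mono fun S hS => ?_).trans (measure_exists_lt_le_of_forall_fin hcont (t := t)
    fun k u => measure_pi_exists_lt_robustLoss_deviation_le hn hdec hlip hr hD hm hA
      (fun i => (u i).2) ht)
  obtain ⟨v, hv, hvt⟩ := hS
  exact ⟨⟨v, hv⟩, hvt⟩

end UniformDeviation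

section Constants

variable {d n : ℕ} {p q : ℝ≥0∞} {r ρ η ε : ℝ} {ℓ : ℝ → ℝ}

theorem two_mul_exp_neg_le_of_eq_sqrt_log {c C K δ t : ℝ} (hn : 0 < n) (hc : 0 < c) (hcC : c ≤ C)
    (hK : 1 ≤ K) (hδ : 0 < δ) (ht : t = 4 * C * √(Real.log (2 * K / δ) / (2 * n))) :
    2 * Real.exp (-(n * t ^ 2 / (8 * c ^ 2))) ≤ δ := by
  have hKδ : 0 < 2 * K / δ := by positivity
  have hlog : Real.log (2 * K / δ) ≤ n * t ^ 2 / (8 * c ^ 2) := by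
    rcases le_total (Real.log (2 * K / δ)) 0 with hneg | hpos
    · exact hneg.trans (by positivity)
    · rw [le_div_iff₀ (by positivity), ht, mul_pow, mul_pow, Real.sq_sqrt (by positivity)]
      have hsq : c ^ 2 ≤ C ^ 2 := pow_le_pow_left₀ hc.le hcC 2
      have hcancel : n * (4 ^ 2 * C ^ 2 * (Real.log (2 * K / δ) / (2 * n))) =
          Real.log (2 * K / δ) * (8 * C ^ 2) := by
        field_simp
        ring
      rw [hcancel]
      gcongr
  calc 2 * Real.exp (-(n * t ^ 2 / (8 * c ^ 2)))
      ≤ 2 * Real.exp (-Real.log (2 * K / δ)) := by gcongr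
    _ = δ / K := by
        rw [Real.exp_neg, Real.exp_log hKδ]
        field_simp
    _ ≤ δ := div_le_self hδ.le hK

theorem dimFactor_nonneg : 0 ≤ dimFactor d q :=
  Real.rpow_nonneg d.cast_nonneg _

theorem rademacherNorm_nonneg [Fact (1 ≤ p)] (x : Fin n → Fin d → ℝ) : 0 ≤ rademacherNorm p x :=
  mul_nonneg (inv_nonneg.2 n.cast_nonneg)
    (div_nonneg (Finset.sum_nonneg fun _ _ => vecNorm_nonneg _) (by positivity))

theorem eight_mul_dimFactor_mul_le [Fact (1 ≤ p)] (hℓ : 0 ≤ ℓ 0) (hr : 0 ≤ r) (hρ : 0 ≤ ρ)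
    (x : Fin n → Fin d → ℝ) {s : ℝ} (hs : 0 ≤ s) :
    8 * dimFactor d q * (1 + r) * ρ * s ≤
      4 * lossBoundBar d ℓ q r ρ * ρ * rademacherNorm p x
        + 4 * lossBoundBar d ℓ q r ρ * (ρ * r / √n) + 6 * lossBound d ℓ q r ρ * s := by
  have hdim := dimFactor_nonneg (d := d) (q := q)
  have hrad := rademacherNorm_nonneg (p := p) x
  have hB : 2 * (dimFactor d q * (1 + r) * ρ) ≤ lossBound d ℓ q r ρ := by
    rw [lossBound]
    linarith
  have hC : 0 ≤ dimFactor d q * (1 + r) * ρ := by positivity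
  have hB0 : 0 ≤ lossBound d ℓ q r ρ := (mul_nonneg zero_le_two hC).trans hB
  have hBbar : 0 ≤ lossBoundBar d ℓ q r ρ := mul_nonneg (mul_nonneg zero_le_two hdim) hB0
  have hdeviation : 8 * dimFactor d q * (1 + r) * ρ * s ≤ 6 * lossBound d ℓ q r ρ * s :=
    mul_le_mul_of_nonneg_right (by linarith) hs
  refine hdeviation.trans (le_add_of_nonneg_left ?_)
  positivity

theorem iterationBound_mul (hη : 0 < η) (hε : 0 < ε) :
    iterationBound d q η ε ρ * (η * ε) = max 1 ((d : ℝ) ^ (1 - 2 * (q⁻¹).toReal)) * ρ ^ 2 := by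
  rw [iterationBound]
  field_simp

theorem iterationBound_nonneg (hη : 0 < η) (hε : 0 < ε) : 0 ≤ iterationBound d q η ε ρ := by
  rw [iterationBound]
  positivity

variable {v : Fin d → ℝ}

theorem vecNorm_two_le_euclideanFactor_mul_of_le [Fact (1 ≤ q)] (hv : vecNorm q v ≤ ρ) :
    vecNorm 2 v ≤ euclideanFactor d q * ρ :=
  (vecNorm_two_le_euclideanFactor_mul v).trans (mul_le_mul_of_nonneg_left hv euclideanFactor_nonneg)

theorem euclideanFactor_mul_vecNorm_two_le [Fact (1 ≤ q)] (hpq : p⁻¹ + q⁻¹ = 1)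
    (hv : vecNorm q v ≤ ρ) : euclideanFactor d p * vecNorm 2 v ≤ dimFactor d q * ρ := by
  rw [← euclideanFactor_mul_euclideanFactor hpq, mul_assoc]
  exact mul_le_mul_of_nonneg_left (vecNorm_two_le_euclideanFactor_mul_of_le hv)
    euclideanFactor_nonneg

theorem sq_vecNorm_two_le_iterationBound_mul [Fact (1 ≤ q)] (hη : 0 < η) (hε : 0 < ε)
    (hv : vecNorm q v ≤ ρ) :
    vecNorm 2 v ^ 2 ≤ iterationBound d q η ε ρ * (η * ε) := by
  calc vecNorm 2 v ^ 2 ≤ (euclideanFactor d q * ρ) ^ 2 :=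
        pow_le_pow_left₀ (vecNorm_nonneg v) (vecNorm_two_le_euclideanFactor_mul_of_le hv) 2
    _ ≤ max 1 ((d : ℝ) ^ (1 - 2 * (q⁻¹).toReal)) * ρ ^ 2 := by
        rw [mul_pow]
        exact mul_le_mul_of_nonneg_right euclideanFactor_sq_le (sq_nonneg ρ)
    _ = iterationBound d q η ε ρ * (η * ε) := (iterationBound_mul hη hε).symm

theorem mul_sq_two_mul_euclideanFactor_le [Fact (1 ≤ p)] (hη : 0 ≤ η) (hε : 0 ≤ ε)
    (hηε : η ≤ ε * (stepConst d p)⁻¹) : η * (2 * euclideanFactor d p) ^ 2 ≤ ε := by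
  have hH := four_mul_euclideanFactor_sq_le_stepConst (d := d) (p := p)
  calc η * (2 * euclideanFactor d p) ^ 2 ≤ ε * (stepConst d p)⁻¹ * stepConst d p :=
        mul_le_mul hηε (by linarith) (sq_nonneg _) (hη.trans hηε)
    _ = ε * ((stepConst d p)⁻¹ * stepConst d p) := mul_assoc _ _ _
    _ ≤ ε := mul_le_of_le_one_right hε inv_mul_le_one

theorem one_le_iterationBound [Fact (1 ≤ p)] [Fact (1 ≤ q)] (hη : 0 < η) (hε : 0 < ε)
    (hηε : η ≤ ε * (stepConst d p)⁻¹) (hv : vecNorm q v ≤ ρ)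
    (hlarge : ε ≤ euclideanFactor d p * vecNorm 2 v) : 1 ≤ iterationBound d q η ε ρ := by
  refine le_of_mul_le_mul_right ?_ (mul_pos hε (mul_pos hη hε))
  calc 1 * (ε * (η * ε)) = η * ε ^ 2 := by ring
    _ ≤ η * (2 * (euclideanFactor d p * vecNorm 2 v)) ^ 2 := by
        gcongr
        linarith
    _ = η * (2 * euclideanFactor d p) ^ 2 * vecNorm 2 v ^ 2 := by ring
    _ ≤ ε * (iterationBound d q η ε ρ * (η * ε)) :=
        mul_le_mul (mul_sq_two_mul_euclideanFactor_le hη.le hε.le hηε)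
          (sq_vecNorm_two_le_iterationBound_mul hη hε hv) (sq_nonneg _) hε.le
    _ = iterationBound d q η ε ρ * (ε * (η * ε)) := mul_left_comm _ _ _

end Constants

section AdversarialTraining

variable {d n : ℕ} {p q : ℝ≥0∞} {r : ℝ} {ℓ g : ℝ → ℝ} {D : Measure ((Fin d → ℝ) × ℝ)}
  [IsProbabilityMeasure D]

theorem measure_pi_not_forall_run_le [Fact (1 ≤ p)] (hn : 0 < n) (hdec : Antitone ℓ)
    (hlip : LipschitzWith 1 ℓ) (hr : 0 ≤ r) (hg : IsSubgradientSelection ℓ g)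
    (hD : ∀ᵐ z ∂D, IsNormalizedExample p z) (hm : 0 < euclideanFactor d p) {η ε K t : ℝ}
    (hη : 0 < η) (hε : 0 < ε) (hηε : η * ((1 + r) * euclideanFactor d p) ^ 2 ≤ ε)
    {v : Fin d → ℝ} (hv : 0 < vecNorm 2 v) (hK : vecNorm 2 v ^ 2 ≤ K * (η * ε)) (ht : 0 ≤ t) :
    (Measure.pi fun _ : Fin n => D)
      {S | ¬ ∀ w : ℕ → Fin d → ℝ, w 0 = 0 → IsAdversarialTrainingRun ℓ g p r η S w →
        ∃ k : ℕ, (k : ℝ) ≤ K ∧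
          populationRobustLoss ℓ p r D (w k) ≤ populationRobustLoss ℓ p r D v + ε + t} ≤
      ENNReal.ofReal (2 * Real.exp
        (-(n * t ^ 2 / (8 * (2 * vecNorm 2 v * ((1 + r) * euclideanFactor d p)) ^ 2)))) := by
  refine (measure_mono_ae ?_).trans
    (measure_pi_exists_mem_ball_lt_robustLoss_deviation_le hn hdec hlip hr hD hm v hv ht)
  filter_upwards [ae_pi_isNormalizedExample hD] with S hS hfail
  obtain ⟨w, hw0, hrun, hlarge⟩ : ∃ w : ℕ → Fin d → ℝ, w 0 = 0 ∧
      IsAdversarialTrainingRun ℓ g p r η S w ∧ ∀ k : ℕ, (k : ℝ) ≤ K →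
        populationRobustLoss ℓ p r D v + ε + t < populationRobustLoss ℓ p r D (w k) := by
    by_contra! hall
    exact hfail hall
  have hdist : vecNorm 2 (w 0 - v) = vecNorm 2 v := by rw [hw0, zero_sub, vecNorm_neg]
  obtain ⟨k, hkK, hk, hnear⟩ := exists_iterate_empiricalRobustLoss_le hn hdec hlip hg hS hη hε
    hηε hrun (hdist.symm ▸ hK)
  exact ⟨w k, hnear.trans_eq hdist, by linarith [hlarge k hkK]⟩

end AdversarialTraining

end AdvTraining

theorem lemma2_general {d n : ℕ} (hn : 0 < n)
    (p q : ℝ≥0∞) (hpq : p⁻¹ + q⁻¹ = 1)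
    (r : ℝ) (hr : 0 ≤ r)
    (ℓ : ℝ → ℝ) (hdec : Antitone ℓ) (hlip : LipschitzWith 1 ℓ)
    (g : ℝ → ℝ) (hg : IsSubgradientSelection ℓ g)
    (D : Measure ((Fin d → ℝ) × ℝ)) [IsProbabilityMeasure D]
    (hlabel : ∀ᵐ z ∂D, z.2 = 1 ∨ z.2 = -1)
    (hnorm : ∀ᵐ z ∂D, vecNorm p z.1 ≤ 1)
    (ρ : ℝ) (wstar : Fin d → ℝ) (hwstar : vecNorm q wstar ≤ ρ)
    (ε : ℝ) (hε : 0 < ε)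
    (η : ℝ) (hη : 0 < η) (hηε : η ≤ ε * (stepConst d p)⁻¹)
    (δ : ℝ) (hδ : 0 < δ) :
    (Measure.pi fun _ : Fin n => D)
      {S | ¬ ∀ w : ℕ → Fin d → ℝ,
          w 0 = 0 → IsAdversarialTrainingRun ℓ g p r η S w →
          ∃ k : ℕ, (k : ℝ) ≤ iterationBound d q η ε ρ ∧
            populationRobustLoss ℓ p r D (w k) ≤
              populationRobustLoss ℓ p r D wstar + ε
                + 8 * dimFactor d q * (1 + r) * ρ *
                    Real.sqrt (Real.log (2 * iterationBound d q η ε ρ / δ) / (2 * n))}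
      ≤ ENNReal.ofReal δ := by
  have : Fact (1 ≤ p) := ⟨ENNReal.inv_le_one.1 (hpq ▸ le_self_add)⟩
  have : Fact (1 ≤ q) := ⟨ENNReal.inv_le_one.1 (hpq ▸ le_add_self)⟩
  have hD : ∀ᵐ z ∂D, IsNormalizedExample p z := hlabel.and hnorm
  have hρ : 0 ≤ ρ := (vecNorm_nonneg wstar).trans hwstar
  set t : ℝ := 8 * dimFactor d q * (1 + r) * ρ *
    √(Real.log (2 * iterationBound d q η ε ρ / δ) / (2 * n)) with ht
  have hdim := dimFactor_nonneg (d := d) (q := q)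
  have ht0 : 0 ≤ t := by positivity
  by_cases hzero : populationRobustLoss ℓ p r D 0 ≤ populationRobustLoss ℓ p r D wstar + ε
  · refine (measure_mono (t := ∅) fun S hfail => ?_).trans (measure_empty.trans_le zero_le)
    exact hfail fun w hw0 _ =>
      ⟨0, by simpa using iterationBound_nonneg hη hε, by rw [hw0]; linarith⟩
  have hr1 : r ≤ 1 := by
    by_contra! h
    have := populationRobustLoss_zero_le_of_one_le hdec hlip h.le hD wstar
    linarith
  have hlarge : ε < euclideanFactor d p * vecNorm 2 wstar := by
    linarith [populationRobustLoss_zero_le hdec hlip hr hD wstar]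
  have hm := euclideanFactor_nonneg.lt_of_ne' (left_ne_zero_of_mul (hε.trans hlarge).ne')
  have hv := (vecNorm_nonneg wstar).lt_of_ne' (right_ne_zero_of_mul (hε.trans hlarge).ne')
  have hstep : η * ((1 + r) * euclideanFactor d p) ^ 2 ≤ ε := by
    refine le_trans ?_ (mul_sq_two_mul_euclideanFactor_le hη.le hε.le hηε)
    gcongr
    linarith
  have hradius : 2 * vecNorm 2 wstar * ((1 + r) * euclideanFactor d p) ≤
      2 * dimFactor d q * (1 + r) * ρ := by
    linear_combination 2 * (1 + r) * euclideanFactor_mul_vecNorm_two_le hpq hwstar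
  refine (measure_pi_not_forall_run_le hn hdec hlip hr hg hD hm hη hε hstep hv
    (sq_vecNorm_two_le_iterationBound_mul hη hε hwstar) ht0).trans
    (ENNReal.ofReal_le_ofReal (two_mul_exp_neg_le_of_eq_sqrt_log hn (by positivity) hradius
      (one_le_iterationBound hη hε hηε hwstar hlarge.le) hδ ?_))
  rw [ht]
  ring

theorem lemma2 {d n : ℕ} (hn : 0 < n)
    (p q : ℝ≥0∞) (hpq : p⁻¹ + q⁻¹ = 1)
    (r : ℝ) (hr : 0 ≤ r)
    (ℓ : ℝ → ℝ) (hconv : ConvexOn ℝ Set.univ ℓ) (hdec : Antitone ℓ)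
    (hlip : LipschitzWith 1 ℓ) (hnonneg : ∀ z, 0 ≤ ℓ z)
    (g : ℝ → ℝ) (hg : IsSubgradientSelection ℓ g)
    (D : Measure ((Fin d → ℝ) × ℝ)) [IsProbabilityMeasure D]
    (hlabel : ∀ᵐ z ∂D, z.2 = 1 ∨ z.2 = -1)
    (hnorm : ∀ᵐ z ∂D, vecNorm p z.1 ≤ 1)
    (ρ : ℝ) (hρ : 0 < ρ) (wstar : Fin d → ℝ) (hwstar : vecNorm q wstar ≤ ρ)
    (ε : ℝ) (hε : 0 < ε)
    (η : ℝ) (hη : 0 < η) (hηε : η ≤ ε * (stepConst d p)⁻¹ / 4)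
    (δ : ℝ) (hδ0 : 0 < δ) (hδ1 : δ < 1) :
    -- the event that fails has (outer) probability at most `δ` over the i.i.d. sample `S`
    (Measure.pi fun _ : Fin n => D)
      {S | ¬ ∀ w : ℕ → Fin d → ℝ,
          w 0 = 0 → IsAdversarialTrainingRun ℓ g p r η S w →
          ∃ k : ℕ, (k : ℝ) ≤ iterationBound d q η ε ρ ∧
            populationRobustLoss ℓ p r D (w k) ≤
              populationRobustLoss ℓ p r D wstar + ε
                + 4 * lossBoundBar d ℓ q r ρ * ρ * rademacherNorm p (fun i => (S i).1)
                + 4 * lossBoundBar d ℓ q r ρ * (ρ * r / Real.sqrt n)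
                + 6 * lossBound d ℓ q r ρ *
                    Real.sqrt (Real.log (2 * iterationBound d q η ε ρ / δ) / (2 * n))}
      ≤ ENNReal.ofReal δ := by
  have : Fact (1 ≤ p) := ⟨ENNReal.inv_le_one.1 (hpq ▸ le_self_add)⟩
  have hstep : η ≤ ε * (stepConst d p)⁻¹ :=
    hηε.trans (div_le_self (hη.le.trans (by linarith)) (by norm_num))
  refine (measure_mono fun S hfail hrun => ?_).trans
    (lemma2_general hn p q hpq r hr ℓ hdec hlip g hg D hlabel hnorm ρ wstar hwstar ε hε η hη hstep
      δ hδ0)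
  refine hfail fun w hw0 hw => ?_
  obtain ⟨k, hkK, hk⟩ := hrun w hw0 hw
  refine ⟨k, hkK, hk.trans ?_⟩
  linarith [eight_mul_dimFactor_mul_le (p := p) (q := q) (hnonneg 0) hr hρ.le (fun i => (S i).1)
    (Real.sqrt_nonneg (Real.log (2 * iterationBound d q η ε ρ / δ) / (2 * n)))]
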